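/- Let $\mathbb{K}$ be a field of characteristic zero with algebraic closure $\mathbb{F}$, let $\mathbb{L}=\mathbb{K}(\alpha)$ be a finite extension of $\mathbb{K}$ of degree $n$, and let $u(t)=\frac{at+b}{t+d}$ with $a,b,d\in\mathbb{L}$ and $ad-b\neq 0$. Write $u(t)=\sum_{i=0}^{n-1}\phi_i(t)\alpha^i$ with (unique) $\phi_i(t)\in\mathbb{K}(t)$. Let $\mathcal{U}\subseteq\mathbb{F}^n$ be the $\alpha$-hypercircle generated by $u$, i.e. the rational curve parametrized by $\phi(t)=(\phi_0(t),\ldots,\phi_{n-1}(t))$ (the Zariski closure of the set of points $\phi(t)$, $t\in\mathbb{F}$), and let $\overline{\mathcal{U}}\subseteq\mathbb{P}^n(\mathbb{F})$ be its projective closure. Let $r=[\mathbb{K}(-d):\mathbb{K}]$. Then: 1. $\mathcal{U}$ defines a curve of degree $r$: $\overline{\mathcal{U}}$ is an irreducible projective curve, and a general hyperplane of $\mathbb{P}^n(\mathbb{F})$ meets it in exactly $r$ points. 2. $\mathcal{U}$ is contained in a linear (affine) variety of dimension $r$ and is not contained in any linear variety of dimension less than $r$. 3. $\overline{\mathcal{U}}$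 is a regular (smooth) curve in $\mathbb{P}^n(\mathbb{F})$. 4. The Hilbert function of $\overline{\mathcal{U}}$ equals its Hilbert polynomial, and $h_{\mathcal{U}}(m)=mr+1$ for every integer $m\ge 0$. -/

import Mathlib

noncomputable section

namespace Hypercircle

open MvPolynomial
open scoped LinearAlgebra.Projectivization

section Parametrization

variable {K L : Type*} [Field K] [Field L] [Algebra K L]

/-- The inclusion `K(t) ⊆ L(t)` induced by `K ⊆ L`. -/
def ratFuncMap (K L : Type*) [Field K] [Field L] [Algebra K L] : RatFunc K →+* RatFunc L :=
  RatFunc.mapRingHom (Polynomial.mapRingHom (algebraMap K L))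
    (nonZeroDivisors_le_comap_nonZeroDivisors_of_injective _
      (Polynomial.map_injective _ (algebraMap K L).injective))

/-- `φ₀, …, φₙ₋₁ ∈ K(t)`, with `n = [L : K]`, are the coordinates of `u ∈ L(t)` in the basis
`1, α, …, αⁿ⁻¹`, that is, `u = ∑ φᵢ αⁱ`. -/
def IsExpansion (α : L) (u : RatFunc L) (φ : Fin (Module.finrank K L) → RatFunc K) : Prop :=
  u = ∑ i, ratFuncMap K L (φ i) * RatFunc.C α ^ (i : ℕ)

theorem ratFuncMap_algebraMap (p : Polynomial K) :
    ratFuncMap K L (algebraMap (Polynomial K) (RatFunc K) p) =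
      algebraMap (Polynomial L) (RatFunc L) (p.map (algebraMap K L)) := by
  have h := RatFunc.map_apply_div (φ := Polynomial.mapRingHom (algebraMap K L))
    (nonZeroDivisors_le_comap_nonZeroDivisors_of_injective _
      (Polynomial.map_injective _ (algebraMap K L).injective)) p 1
  simpa [ratFuncMap, RatFunc.coe_mapRingHom_eq_coe_map] using h

theorem linearIndependent_powers [FiniteDimensional K L] {α : L}
    (hα : IntermediateField.adjoin K {α} = ⊤) :
    LinearIndependent K (fun i : Fin (Module.finrank K L) => α ^ (i : ℕ)) := by
  have h := linearIndependent_pow (K := K) α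
  rwa [(Field.primitive_element_iff_minpoly_natDegree_eq K α).1 hα] at h

theorem existsUnique_expansion [FiniteDimensional K L] {α : L}
    (hα : IntermediateField.adjoin K {α} = ⊤) (u : RatFunc L) :
    ∃! φ : Fin (Module.finrank K L) → RatFunc K, IsExpansion α u φ := by
  have hli := linearIndependent_powers hα
  have : Nonempty (Fin (Module.finrank K L)) := ⟨⟨0, Module.finrank_pos⟩⟩
  let b := basisOfLinearIndependentOfCardEqFinrank hli (Fintype.card_fin _)
  have hb : ∀ i, b i = α ^ (i : ℕ) := fun i => by simp [b]
  have hinj : Function.Injective (algebraMap (Polynomial L) (RatFunc L)) :=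
    RatFunc.algebraMap_injective L
  refine existsUnique_of_exists_of_unique ?_ ?_
  · obtain ⟨G, hG, h, hh⟩ :=
      Polynomial.exists_dvd_map_of_isAlgebraic (R := K) (RatFunc.denom_ne_zero u)
    let P : Fin (Module.finrank K L) → Polynomial K := fun i =>
      ∑ k ∈ (u.num * h).support, Polynomial.monomial k (b.repr ((u.num * h).coeff k) i)
    have hP : ∑ i, (P i).map (algebraMap K L) * Polynomial.C α ^ (i : ℕ) = u.num * h := by
      ext k
      simp only [P, Polynomial.finsetSum_coeff, ← Polynomial.C_pow, Polynomial.coeff_mul_C,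
        Polynomial.coeff_map, Polynomial.coeff_monomial]
      have h1 := b.sum_repr ((u.num * h).coeff k)
      conv_rhs => rw [← h1]
      refine Finset.sum_congr rfl fun i _ => ?_
      rw [Finset.sum_ite_eq', hb, Algebra.smul_def]
      split_ifs with hk
      · rfl
      · rw [Polynomial.notMem_support_iff] at hk
        simp [hk]
    have hGL : algebraMap (Polynomial L) (RatFunc L) (G.map (algebraMap K L)) ≠ 0 := by
      rw [Ne, map_eq_zero_iff _ hinj, Polynomial.map_eq_zero]
      exact hG
    have hd : algebraMap (Polynomial L) (RatFunc L) u.denom ≠ 0 := by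
      rw [Ne, map_eq_zero_iff _ hinj]
      exact RatFunc.denom_ne_zero u
    refine ⟨fun i => algebraMap _ _ (P i) / algebraMap _ _ G, ?_⟩
    have h2 : ∑ i, ratFuncMap K L (algebraMap _ _ (P i) / algebraMap _ _ G) *
        RatFunc.C α ^ (i : ℕ) =
        algebraMap (Polynomial L) (RatFunc L) (u.num * h) /
          algebraMap (Polynomial L) (RatFunc L) (G.map (algebraMap K L)) := by
      rw [← hP, map_sum, Finset.sum_div]
      refine Finset.sum_congr rfl fun i _ => ?_
      rw [map_div₀, ratFuncMap_algebraMap, ratFuncMap_algebraMap, map_mul, map_pow,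
        RatFunc.algebraMap_C]
      ring
    rw [IsExpansion, h2, eq_div_iff hGL]
    conv_lhs => rw [← RatFunc.num_div_denom u]
    rw [hh, map_mul, map_mul]
    field_simp
  · intro φ ψ hφ hψ
    have h0 : ∑ i, ratFuncMap K L (φ i - ψ i) * RatFunc.C α ^ (i : ℕ) = 0 := by
      simp only [map_sub, sub_mul, Finset.sum_sub_distrib]
      rw [IsExpansion] at hφ hψ
      rw [← hφ, ← hψ, sub_self]
    obtain ⟨⟨D, hD⟩, hint⟩ := IsLocalization.exist_integer_multiples_of_finite
      (nonZeroDivisors (Polynomial K)) (fun i => φ i - ψ i)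
    choose P hP using hint
    have hP' : ∀ i, algebraMap (Polynomial K) (RatFunc K) (P i) =
        algebraMap _ _ D * (φ i - ψ i) := fun i => by
      exact (hP i).trans (Algebra.smul_def _ _)
    have h1 : ∑ i, (P i).map (algebraMap K L) * Polynomial.C α ^ (i : ℕ) = 0 := by
      apply hinj
      rw [map_zero, map_sum, ← mul_zero (ratFuncMap K L (algebraMap _ _ D)), ← h0,
        Finset.mul_sum]
      refine Finset.sum_congr rfl fun i _ => ?_
      rw [map_mul, ← ratFuncMap_algebraMap, hP', map_pow, RatFunc.algebraMap_C, map_mul,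
        mul_assoc]
    have hP0 : ∀ i, P i = 0 := by
      intro i
      ext k
      have h3 := congrArg (fun q => Polynomial.coeff q k) h1
      simp only [Polynomial.finsetSum_coeff, ← Polynomial.C_pow, Polynomial.coeff_mul_C,
        Polynomial.coeff_map, Polynomial.coeff_zero] at h3
      simp only [← Algebra.smul_def] at h3
      simpa using Fintype.linearIndependent_iff.1 hli _ h3 i
    funext i
    have h4 := hP' i
    rw [hP0, map_zero, zero_eq_mul] at h4
    rcases h4 with h4 | h4
    · exact absurd ((map_eq_zero_iff _ (RatFunc.algebraMap_injective K)).1 h4)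
        (nonZeroDivisors.ne_zero hD)
    · exact sub_eq_zero.1 h4

/-- The coordinates `φ = (φ₀, …, φₙ₋₁)` of `u ∈ L(t)` in the basis `1, α, …, αⁿ⁻¹`, where `α` is
a primitive element of `L` over `K`. -/
def coordinates [FiniteDimensional K L] {α : L} (hα : IntermediateField.adjoin K {α} = ⊤)
    (u : RatFunc L) : Fin (Module.finrank K L) → RatFunc K :=
  (existsUnique_expansion hα u).choose

theorem isExpansion_coordinates [FiniteDimensional K L] {α : L}
    (hα : IntermediateField.adjoin K {α} = ⊤) (u : RatFunc L) :
    IsExpansion α u (coordinates hα u) :=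
  (existsUnique_expansion hα u).choose_spec.1

/-- The points `φ(t)` of `Fⁿ`, for those `t ∈ F` at which every `φᵢ` is defined. -/
def parametrizedPoints (F : Type*) [Field F] [Algebra K F] {n : ℕ} (φ : Fin n → RatFunc K) :
    Set (Fin n → F) :=
  {x | ∃ t : F, ∀ i, Polynomial.eval₂ (algebraMap K F) t (φ i).denom ≠ 0 ∧
    x i = Polynomial.eval₂ (algebraMap K F) t (φ i).num /
      Polynomial.eval₂ (algebraMap K F) t (φ i).denom}

/-- The `α`-hypercircle generated by `u ∈ L(t)`: the curve in `Fⁿ` parametrized by the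
coordinates of `u`, i.e. the Zariski closure of the set of points `φ(t)`. -/
def hypercircle (F : Type*) [Field F] [Algebra K F] [FiniteDimensional K L] {α : L}
    (hα : IntermediateField.adjoin K {α} = ⊤) (u : RatFunc L) :
    Set (Fin (Module.finrank K L) → F) :=
  zeroLocus F (vanishingIdeal F (parametrizedPoints F (coordinates hα u)))

end Parametrization

section Projective

variable {F : Type*} [Field F] {N : ℕ}

/-- The homogeneous ideal of a subset of `ℙᴺ(F)`, generated by the homogeneous polynomials
vanishing on it. -/
def homogeneousIdeal (Z : Set (ℙ F (Fin (N + 1) → F))) : Ideal (MvPolynomial (Fin (N + 1)) F) :=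
  Ideal.span {f | (∃ m, f.IsHomogeneous m) ∧ ∀ p ∈ Z, eval p.rep f = 0}

/-- The Zariski closure of a subset of `ℙᴺ(F)`. -/
def zariskiClosure (Z : Set (ℙ F (Fin (N + 1) → F))) : Set (ℙ F (Fin (N + 1) → F)) :=
  {p | ∀ f ∈ homogeneousIdeal Z, eval p.rep f = 0}

theorem snoc_one_ne_zero (x : Fin N → F) :
    (Fin.snoc x 1 : Fin (N + 1) → F) ≠ 0 := fun h => by
  simpa using congrFun h (Fin.last N)

/-- The projective closure in `ℙᴺ(F)` of a subset of `Fᴺ`, where `x ∈ Fᴺ` is identified with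
`[x₀ : ⋯ : x_{N-1} : 1]`. -/
def projectiveClosure (U : Set (Fin N → F)) : Set (ℙ F (Fin (N + 1) → F)) :=
  zariskiClosure
    ((fun x => Projectivization.mk F (Fin.snoc x 1 : Fin (N + 1) → F) (snoc_one_ne_zero x)) '' U)

/-- `Z` is a projective curve: a Zariski closed irreducible subset of dimension one, i.e. its
homogeneous ideal is prime and its homogeneous coordinate ring has transcendence degree two. -/
structure IsProjectiveCurve (Z : Set (ℙ F (Fin (N + 1) → F))) : Prop where
  isClosed : zariskiClosure Z = Z
  isPrime : (homogeneousIdeal Z).IsPrime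
  trdeg : Algebra.trdeg F (MvPolynomial (Fin (N + 1)) F ⧸ homogeneousIdeal Z) = 2

/-- The hyperplane `∑ cᵢ Xᵢ = 0` of `ℙᴺ(F)` (for `c ≠ 0`). -/
def hyperplane (c : Fin (N + 1) → F) : Set (ℙ F (Fin (N + 1) → F)) :=
  {p | ∑ i, c i * p.rep i = 0}

/-- The projective curve `Z` has degree `r`: a general hyperplane, i.e. every hyperplane outside
a proper Zariski closed subset of the dual projective space, meets `Z` in exactly `r` points. -/
def HasDegree (Z : Set (ℙ F (Fin (N + 1) → F))) (r : ℕ) : Prop :=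
  ∃ G : MvPolynomial (Fin (N + 1)) F, G ≠ 0 ∧ (∃ m, G.IsHomogeneous m) ∧
    ∀ c : Fin (N + 1) → F, c ≠ 0 → eval c G ≠ 0 → (Z ∩ hyperplane c).encard = r

/-- The projective curve `Z ⊆ ℙᴺ(F)` is regular: at every point of `Z` the Jacobian matrix of the
polynomials of its homogeneous ideal has rank `N - 1`. -/
def IsRegularCurve (Z : Set (ℙ F (Fin (N + 1) → F))) : Prop :=
  IsProjectiveCurve Z ∧ ∀ p ∈ Z,
    Module.finrank F (Submodule.span F
      {w : Fin (N + 1) → F | ∃ f ∈ homogeneousIdeal Z, w = fun j => eval p.rep (pderiv j f)}) + 1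
      = N

/-- The Hilbert function of `Z`: the dimension of the degree `m` part of the homogeneous
coordinate ring. -/
def hilbertFunction (Z : Set (ℙ F (Fin (N + 1) → F))) (m : ℕ) : ℕ :=
  Module.finrank F (homogeneousSubmodule (Fin (N + 1)) F m ⧸
    ((homogeneousIdeal Z).restrictScalars F).comap
      (homogeneousSubmodule (Fin (N + 1)) F m).subtype)

/-- `P` is the Hilbert polynomial of `Z`: it agrees with the Hilbert function in all large
degrees. (There is at most one such `P`.) -/
def IsHilbertPolynomial (Z : Set (ℙ F (Fin (N + 1) → F))) (P : Polynomial ℚ) : Prop :=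
  ∀ᶠ m : ℕ in Filter.atTop, (hilbertFunction Z m : ℚ) = P.eval (m : ℚ)

end Projective

end Hypercircle

end

/-! Up to a projective linear embedding, the hypercircle is the rational normal curve of degree `r`.
Put `x = -d`, `c = b - a * d`, let `M` be the minimal polynomial of `x` over `K`, and write `M = (t
- x) m(t)`. Then `u = a + c / (t - x) = (a M + c m) / M`. In the basis of powers of `α` the
coordinates are `φᵢ = aᵢ + (∑ₖ Qᵢₖ tᵏ) / M` with `k < r`. The coefficients of `m` form a `K`-basis
of `K(x)` and `c ≠ 0`, so `Q` has rank `r` (`numeratorMatrix_mulVec_eq_zero`). Hence `[φ : 1] = A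
(1, t, …, tʳ)` for a matrix `A` built from `Q`, `aᵢ` and `M`. It has a left inverse `B`, since `M`
is monic of degree `r` (`exists_mul_curveMatrix_eq_one`). The homogeneous ideal of the projective
closure is the kernel of `Xⱼ ↦ s · (A (1, t, …, tʳ))ⱼ` (`homogeneousIdeal_projectiveClosure`).
Everything is read off this kernel. It is prime, and its quotient has transcendence degree two. Its
degree `m` part corresponds to the polynomials in `t` of degree at most `m r`, which gives the
Hilbert function. Linear forms and quadratic minors in it determine the points and the tangent
spaces. A hyperplane section is the root set of a polynomial of degree `r`, separable for a general
hyperplane. The linear span comes from the rank of `Q`. -/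

namespace Hypercircle

open MvPolynomial
open scoped LinearAlgebra.Projectivization

/-! ### Linear images of the rational normal curve: ideal and points. -/

noncomputable section RationalNormalCurve

variable {F : Type*} [Field F] {ι : Type*} {r : ℕ}

theorem _root_.MvPolynomial.IsHomogeneous.aeval_mul_right {R S σ : Type*} [CommSemiring R]
    [CommSemiring S] [Algebra R S] {f : MvPolynomial σ R} {m : ℕ} (hf : f.IsHomogeneous m)
    (c : σ → S) (s : S) :
    aeval (fun j => c j * s) f = aeval c f * s ^ m := by
  conv_lhs => rw [f.as_sum]
  conv_rhs => rw [f.as_sum]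
  rw [map_sum, map_sum, Finset.sum_mul]
  refine Finset.sum_congr rfl fun e he => ?_
  have hdeg : e.degree = m := by
    by_contra h
    exact (mem_support_iff.1 he) (hf.coeff_eq_zero h)
  rw [aeval_monomial, aeval_monomial, mul_assoc]
  congr 1
  simp only [Finsupp.prod, mul_pow, Finset.prod_mul_distrib, Finset.prod_pow_eq_pow_sum]
  rw [← hdeg, Finsupp.degree_apply]

theorem _root_.MvPolynomial.IsHomogeneous.eval_smul {R σ : Type*} [CommSemiring R]
    {f : MvPolynomial σ R} {m : ℕ} (hf : f.IsHomogeneous m) (c : R) (v : σ → R) :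
    eval (c • v) f = c ^ m * eval v f := by
  have h := hf.aeval_mul_right v c
  simp only [← coe_aeval_eq_eval, RingHom.coe_coe]
  rw [mul_comm, ← h]
  congr 2
  ext j
  simp [mul_comm]

/-- The polynomials `∑ᵢ Aⱼᵢ tⁱ` whose coefficients are the rows of `A`. -/
def rowPoly (A : Matrix ι (Fin (r + 1)) F) (j : ι) : Polynomial F :=
  ∑ i, Polynomial.C (A j i) * Polynomial.X ^ (i : ℕ)

theorem eval_rowPoly (A : Matrix ι (Fin (r + 1)) F) (j : ι) (t : F) :
    (rowPoly A j).eval t = A.mulVec (fun i => t ^ (i : ℕ)) j := by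
  simp [rowPoly, Polynomial.eval_finsetSum, Matrix.mulVec, dotProduct]

/-- The homomorphism `Xⱼ ↦ s · ∑ᵢ Aⱼᵢ tⁱ`, which parametrizes the affine cone over a curve. -/
def paramHom (A : Matrix ι (Fin (r + 1)) F) :
    MvPolynomial ι F →ₐ[F] Polynomial (Polynomial F) :=
  aeval fun j => Polynomial.C (rowPoly A j) * Polynomial.X

/-- The homogeneous ideal of the curve parametrized by the rows of `A`. -/
def paramIdeal (A : Matrix ι (Fin (r + 1)) F) : Ideal (MvPolynomial ι F) :=
  RingHom.ker (paramHom A)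

theorem mem_paramIdeal {A : Matrix ι (Fin (r + 1)) F} {f : MvPolynomial ι F} :
    f ∈ paramIdeal A ↔ paramHom A f = 0 := RingHom.mem_ker

theorem paramHom_of_isHomogeneous (A : Matrix ι (Fin (r + 1)) F) {f : MvPolynomial ι F} {m : ℕ}
    (hf : f.IsHomogeneous m) :
    paramHom A f = Polynomial.C (aeval (rowPoly A) f) * Polynomial.X ^ m := by
  rw [paramHom, hf.aeval_mul_right]
  congr 1
  exact aeval_algebraMap_apply (Polynomial (Polynomial F)) (rowPoly A) f

/-- The outer variable `s` records the degree, which makes the kernel a homogeneous ideal. -/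
theorem coeff_paramHom (A : Matrix ι (Fin (r + 1)) F) (f : MvPolynomial ι F) (m : ℕ) :
    (paramHom A f).coeff m = aeval (rowPoly A) (homogeneousComponent m f) := by
  conv_lhs => rw [← sum_homogeneousComponent f]
  simp only [map_sum, Polynomial.finsetSum_coeff,
    paramHom_of_isHomogeneous A (homogeneousComponent_isHomogeneous _ f),
    Polynomial.coeff_C_mul, Polynomial.coeff_X_pow, mul_ite, mul_one, mul_zero]
  rw [Finset.sum_ite_eq]
  split_ifs with h
  · rfl
  · rw [homogeneousComponent_eq_zero _ _ (by simpa using h), map_zero]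

theorem mem_paramIdeal_of_isHomogeneous {A : Matrix ι (Fin (r + 1)) F} {f : MvPolynomial ι F}
    {m : ℕ} (hf : f.IsHomogeneous m) : f ∈ paramIdeal A ↔ aeval (rowPoly A) f = 0 := by
  rw [mem_paramIdeal, paramHom_of_isHomogeneous A hf,
    mul_eq_zero_iff_right (pow_ne_zero _ Polynomial.X_ne_zero), Polynomial.C_eq_zero]

theorem mem_paramIdeal_iff {A : Matrix ι (Fin (r + 1)) F} {f : MvPolynomial ι F} :
    f ∈ paramIdeal A ↔ ∀ m, aeval (rowPoly A) (homogeneousComponent m f) = 0 := by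
  rw [mem_paramIdeal, Polynomial.ext_iff]
  simp [coeff_paramHom]

/-- The vectors of the affine cone over the standard rational normal curve of degree `r`. -/
def IsMoment (y : Fin (r + 1) → F) : Prop :=
  (∃ c t : F, y = fun i : Fin (r + 1) => c * t ^ (i : ℕ)) ∨ ∃ c : F, y = Pi.single (Fin.last r) c

/-- If `y 0 ≠ 0`, the relations `yᵢ₊₁ y₀ = yᵢ y₁` make `y` a geometric progression of ratio `y₁ /
y₀`. If `y 0 = 0`, the relations `yᵢ₊₁² = yᵢ yᵢ₊₂` kill every coordinate but the last in turn. -/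
theorem isMoment_of_minors {y : Fin (r + 1) → F}
    (h : ∀ i j k l : Fin (r + 1), (i : ℕ) + j = k + l → y i * y j = y k * y l) : IsMoment y := by
  rcases Nat.eq_zero_or_pos r with rfl | hr
  · right
    refine ⟨y 0, ?_⟩
    ext i
    fin_cases i
    simp
  by_cases h0 : y 0 = 0
  · right
    refine ⟨y (Fin.last r), ?_⟩
    have hz : ∀ i : ℕ, ∀ hi : i < r, y ⟨i, by omega⟩ = 0 := by
      intro i
      induction i with
      | zero => intro _; exact h0
      | succ i ih =>
        intro hi
        have h1 := h ⟨i + 1, by omega⟩ ⟨i + 1, by omega⟩ ⟨i, by omega⟩ ⟨i + 2, by omega⟩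
          (by simp; omega)
        rw [ih (by omega), zero_mul] at h1
        exact mul_self_eq_zero.1 h1
    ext i
    by_cases hi : i = Fin.last r
    · subst hi; simp
    · rw [Pi.single_eq_of_ne hi]
      exact hz i (Fin.val_lt_last hi)
  · left
    refine ⟨y 0, y ⟨1, by omega⟩ / y 0, ?_⟩
    have hz : ∀ i : ℕ, ∀ hi : i < r + 1, y ⟨i, hi⟩ = y 0 * (y ⟨1, by omega⟩ / y 0) ^ i := by
      intro i
      induction i with
      | zero => intro _; simp
      | succ i ih =>
        intro hi
        have h1 := h ⟨i + 1, hi⟩ 0 ⟨i, by omega⟩ ⟨1, by omega⟩ (by simp)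
        rw [ih (by omega)] at h1
        rw [pow_succ]
        field_simp at h1 ⊢
        linear_combination h1
    ext i
    exact hz i i.2

theorem IsMoment.smul {y : Fin (r + 1) → F} (hy : IsMoment y) (c : F) : IsMoment (c • y) := by
  rcases hy with ⟨d, t, rfl⟩ | ⟨d, rfl⟩
  · exact Or.inl ⟨c * d, t, by ext i; simp [mul_assoc]⟩
  · exact Or.inr ⟨c * d, by rw [← Pi.single_smul, smul_eq_mul]⟩

theorem eval_mulVec_moment {A : Matrix ι (Fin (r + 1)) F} {f : MvPolynomial ι F}
    (hf : f ∈ paramIdeal A) (c t : F) :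
    eval (A.mulVec fun i : Fin (r + 1) => c * t ^ (i : ℕ)) f = 0 := by
  have h : eval (A.mulVec fun i => c * t ^ (i : ℕ)) f =
      ((paramHom A f).eval (Polynomial.C c)).eval t := by
    have : (MvPolynomial.aeval (A.mulVec fun i => c * t ^ (i : ℕ)) : MvPolynomial ι F →ₐ[F] F) =
      ((Polynomial.aeval t).comp
        ((Polynomial.aeval (Polynomial.C c : Polynomial F)).restrictScalars F)).comp
          (paramHom A) := by
      refine MvPolynomial.algHom_ext fun j => ?_
      simp only [aeval_X, AlgHom.comp_apply, paramHom, AlgHom.restrictScalars_apply, map_mul,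
        Polynomial.aeval_C, Polynomial.aeval_X, Algebra.algebraMap_self, RingHom.id_apply,
        Polynomial.coe_aeval_eq_eval, eval_rowPoly]
      simp only [Matrix.mulVec, dotProduct, Finset.sum_mul]
      exact Finset.sum_congr rfl fun i _ => by ring
    have h2 := DFunLike.congr_fun this f
    rw [← coe_aeval_eq_eval, RingHom.coe_coe, h2]
    simp only [AlgHom.comp_apply, AlgHom.restrictScalars_apply, Polynomial.coe_aeval_eq_eval]
  rw [h, mem_paramIdeal.1 hf]
  simp

theorem eval_mulVec_of_isMoment [Infinite F] {A : Matrix ι (Fin (r + 1)) F}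
    {f : MvPolynomial ι F} (hf : f ∈ paramIdeal A) {y : Fin (r + 1) → F} (hy : IsMoment y) :
    eval (A.mulVec y) f = 0 := by
  rcases hy with ⟨c, t, rfl⟩ | ⟨c, rfl⟩
  · exact eval_mulVec_moment hf c t
  -- The point at infinity is a limit: for `s ≠ 0` the vector `c s^(r - i)` is the cone point with
  -- scalar `c sʳ` and parameter `s⁻¹`. So `f` vanishes along the arc for infinitely many `s`, hence
  -- also at `s = 0`.
  let g : ι → Polynomial F := fun j =>
    ∑ i : Fin (r + 1), Polynomial.C (A j i * c) * Polynomial.X ^ (r - i)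
  have hg : ∀ s : F, (aeval g f).eval s =
      eval (A.mulVec fun i => c * s ^ (r - (i : ℕ))) f := by
    intro s
    have h1 : (Polynomial.aeval s) (aeval g f) = _ :=
      DFunLike.congr_fun (MvPolynomial.comp_aeval g (Polynomial.aeval (R := F) s)) f
    rw [Polynomial.coe_aeval_eq_eval] at h1
    rw [h1, ← coe_aeval_eq_eval, RingHom.coe_coe]
    congr 2
    ext j
    simp [g, Polynomial.eval_finsetSum, Matrix.mulVec, dotProduct, mul_assoc]
  have h0 : aeval g f = 0 := by
    refine Polynomial.eq_zero_of_infinite_isRoot _ (Set.Infinite.mono ?_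
      (Set.finite_singleton (0 : F)).infinite_compl)
    intro s hs
    have hs : s ≠ 0 := hs
    rw [Set.mem_ofPred_eq, Polynomial.IsRoot, hg]
    convert eval_mulVec_moment hf (c * s ^ r) s⁻¹ using 4
    ext i
    have hi : (i : ℕ) ≤ r := by omega
    rw [mul_assoc, inv_pow, pow_sub₀ s hs hi]
  have h1 := hg 0
  rw [h0, Polynomial.eval_zero] at h1
  convert h1.symm using 4
  ext i
  by_cases hi : i = Fin.last r
  · subst hi; simp
  · have : r - (i : ℕ) ≠ 0 := by have := Fin.val_lt_last hi; omega
    simp [hi, this]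

theorem linear_mem_paramIdeal [Fintype ι] {A : Matrix ι (Fin (r + 1)) F} {w : ι → F}
    (hw : Matrix.vecMul w A = 0) : ∑ j, C (w j) * X j ∈ paramIdeal A := by
  have hh : (∑ j, C (w j) * X j : MvPolynomial ι F).IsHomogeneous 1 :=
    IsHomogeneous.sum _ _ _ fun _ _ => isHomogeneous_C_mul_X _ _
  rw [mem_paramIdeal_of_isHomogeneous hh]
  simp only [map_sum, map_mul, aeval_X, algHom_C, rowPoly, Finset.mul_sum]
  rw [Finset.sum_comm]
  refine Finset.sum_eq_zero fun i _ => ?_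
  have := congrFun hw i
  simp only [Matrix.vecMul, dotProduct, Pi.zero_apply] at this
  rw [← zero_mul (Polynomial.X ^ (i : ℕ) : Polynomial F), ← Polynomial.C_0, ← this, map_sum,
    Finset.sum_mul]
  refine Finset.sum_congr rfl fun j _ => ?_
  rw [Polynomial.C_mul, mul_assoc]
  rfl

/-- The linear forms `∑ⱼ Bᵢⱼ Xⱼ` given by the rows of `B`. -/
def rowForm {κ : Type*} [Fintype ι] (B : Matrix κ ι F) (i : κ) : MvPolynomial ι F :=
  ∑ j, C (B i j) * X j

theorem rowForm_isHomogeneous {κ : Type*} [Fintype ι] (B : Matrix κ ι F) (i : κ) :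
    (rowForm B i).IsHomogeneous 1 :=
  IsHomogeneous.sum _ _ _ fun _ _ => isHomogeneous_C_mul_X _ _

theorem eval_rowForm {κ : Type*} [Fintype ι] (B : Matrix κ ι F) (i : κ) (v : ι → F) :
    eval v (rowForm B i) = B.mulVec v i := by
  simp [rowForm, Matrix.mulVec, dotProduct]

theorem aeval_rowForm [Fintype ι] {A : Matrix ι (Fin (r + 1)) F} {B : Matrix (Fin (r + 1)) ι F}
    (hBA : B * A = 1) (i : Fin (r + 1)) :
    aeval (rowPoly A) (rowForm B i) = Polynomial.X ^ (i : ℕ) := by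
  simp only [rowForm, map_sum, map_mul, aeval_X, algHom_C, rowPoly, Finset.mul_sum]
  rw [Finset.sum_comm]
  have h : ∀ k : Fin (r + 1), ∑ j, (algebraMap F (Polynomial F)) (B i j) *
      (Polynomial.C (A j k) * Polynomial.X ^ (k : ℕ)) =
      if i = k then Polynomial.X ^ (k : ℕ) else 0 := by
    intro k
    have := congrFun (congrFun hBA i) k
    rw [Matrix.mul_apply, Matrix.one_apply] at this
    have h2 : (if i = k then Polynomial.X ^ (k : ℕ) else 0 : Polynomial F) =
      Polynomial.C (if i = k then 1 else 0) * Polynomial.X ^ (k : ℕ) := by split_ifs <;> simp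
    rw [h2, ← this, map_sum, Finset.sum_mul]
    refine Finset.sum_congr rfl fun j _ => ?_
    rw [Polynomial.C_mul, mul_assoc]
    rfl
  simp only [h]
  simp

theorem minor_mem_paramIdeal [Fintype ι] {A : Matrix ι (Fin (r + 1)) F}
    {B : Matrix (Fin (r + 1)) ι F} (hBA : B * A = 1) {i j k l : Fin (r + 1)}
    (h : (i : ℕ) + j = k + l) :
    rowForm B i * rowForm B j - rowForm B k * rowForm B l ∈ paramIdeal A := by
  have hh : (rowForm B i * rowForm B j - rowForm B k * rowForm B l).IsHomogeneous 2 :=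
    ((rowForm_isHomogeneous B i).mul (rowForm_isHomogeneous B j)).sub
      ((rowForm_isHomogeneous B k).mul (rowForm_isHomogeneous B l))
  rw [mem_paramIdeal_of_isHomogeneous hh]
  simp only [map_sub, map_mul, aeval_rowForm hBA, ← pow_add, h, sub_self]

/-- The rows of `A * B - 1` annihilate `A`, so they annihilate `v`. Thus the linear forms killing
`A` cut out its column space. -/
theorem mulVec_mulVec_of_annihilated {κ : Type*} [Fintype κ] [DecidableEq κ] [Fintype ι]
    {A : Matrix ι κ F} {B : Matrix κ ι F} (hBA : B * A = 1) {v : ι → F}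
    (hv : ∀ w : ι → F, Matrix.vecMul w A = 0 → dotProduct w v = 0) :
    A.mulVec (B.mulVec v) = v := by
  classical
  ext j
  have h := hv ((A * B - 1 : Matrix ι ι F) j) (by
    have : (A * B - 1 : Matrix ι ι F) * A = 0 := by
      rw [Matrix.sub_mul, Matrix.mul_assoc, hBA, Matrix.mul_one, Matrix.one_mul, sub_self]
    exact congrFun this j)
  have h2 : (A * B - 1).mulVec v j = 0 := h
  rw [Matrix.sub_mulVec, Matrix.one_mulVec, ← Matrix.mulVec_mulVec] at h2
  exact sub_eq_zero.1 h2

/-- The linear forms of the ideal force `v = A (B v)`, and the quadratic minors in the forms of `B`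
force `B v` onto the moment cone. -/
theorem zeroLocus_paramIdeal [Infinite F] [Fintype ι] {A : Matrix ι (Fin (r + 1)) F}
    {B : Matrix (Fin (r + 1)) ι F} (hBA : B * A = 1) (v : ι → F) :
    (∀ f ∈ paramIdeal A, eval v f = 0) ↔ ∃ y, IsMoment y ∧ v = A.mulVec y := by
  constructor
  · intro h
    refine ⟨B.mulVec v, isMoment_of_minors fun i j k l hij => ?_,
      (mulVec_mulVec_of_annihilated hBA fun w hw => ?_).symm⟩
    · have := h _ (minor_mem_paramIdeal hBA hij)
      simp only [map_sub, map_mul, eval_rowForm] at this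
      exact sub_eq_zero.1 this
    · have := h _ (linear_mem_paramIdeal hw)
      simpa [dotProduct] using this
  · rintro ⟨y, hy, rfl⟩ f hf
    exact eval_mulVec_of_isMoment hf hy

end RationalNormalCurve

/-! ### Homogeneous coordinate ring: transcendence degree and Hilbert function. -/

noncomputable section CoordinateRing

variable {F : Type*} [Field F] {ι : Type*} {r : ℕ}

instance isPrime_paramIdeal (A : Matrix ι (Fin (r + 1)) F) : (paramIdeal A).IsPrime :=
  RingHom.ker_isPrime _

theorem paramHom_rowForm [Fintype ι] {A : Matrix ι (Fin (r + 1)) F}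
    {B : Matrix (Fin (r + 1)) ι F} (hBA : B * A = 1) (i : Fin (r + 1)) :
    paramHom A (rowForm B i) = Polynomial.C (Polynomial.X ^ (i : ℕ)) * Polynomial.X := by
  rw [paramHom_of_isHomogeneous A (rowForm_isHomogeneous B i), aeval_rowForm hBA, pow_one]

theorem isAlgebraic_of_algebraMap_mul_eq {R S : Type*} [CommRing R] [CommRing S] [Algebra R S]
    {a b : R} {x : S} (ha : a ≠ 0) (h : algebraMap R S a * x = algebraMap R S b) :
    IsAlgebraic R x := by
  refine ⟨Polynomial.C a * Polynomial.X - Polynomial.C b, fun h1 => ha ?_, ?_⟩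
  · simpa using congrArg (fun q => Polynomial.coeff q 1) h1
  · simp [h]

/-- The range contains `s` and `s t`, the latter because `0 < r`, so `t` satisfies a linear equation
over it. -/
theorem isAlgebraic_range_paramHom [Fintype ι] {A : Matrix ι (Fin (r + 1)) F}
    {B : Matrix (Fin (r + 1)) ι F} (hBA : B * A = 1) (hr : 0 < r) :
    Algebra.IsAlgebraic (paramHom A).range (Polynomial (Polynomial F)) := by
  let R := (paramHom A).range
  have hs : IsAlgebraic R (Polynomial.X : Polynomial (Polynomial F)) := by
    have h := paramHom_rowForm hBA 0
    simp only [Fin.val_zero, pow_zero, Polynomial.C_1, one_mul] at h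
    exact isAlgebraic_algebraMap (⟨Polynomial.X, ⟨_, h⟩⟩ : R)
  have ht : IsAlgebraic R (Polynomial.C Polynomial.X : Polynomial (Polynomial F)) := by
    have h0 := paramHom_rowForm hBA 0
    simp only [Fin.val_zero, pow_zero, Polynomial.C_1, one_mul] at h0
    have h := paramHom_rowForm hBA ⟨1, by omega⟩
    simp only [pow_one] at h
    let s : R := ⟨Polynomial.X, ⟨_, h0⟩⟩
    let st : R := ⟨Polynomial.C Polynomial.X * Polynomial.X, ⟨_, h⟩⟩
    exact isAlgebraic_of_algebraMap_mul_eq (a := s) (b := st)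
      (fun h1 => Polynomial.X_ne_zero (congrArg Subtype.val h1)) (mul_comm _ _)
  refine ⟨fun q => ?_⟩
  change q ∈ Subalgebra.algebraicClosure R (Polynomial (Polynomial F))
  rw [← Polynomial.sum_monomial_eq q, Polynomial.sum]
  refine sum_mem fun n _ => ?_
  rw [← Polynomial.C_mul_X_pow_eq_monomial]
  refine mul_mem ?_ (pow_mem hs n)
  rw [← Polynomial.sum_monomial_eq (q.coeff n), Polynomial.sum, map_sum]
  refine sum_mem fun k _ => ?_
  rw [← Polynomial.C_mul_X_pow_eq_monomial, map_mul, map_pow]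
  refine mul_mem ?_ (pow_mem ht k)
  have : Polynomial.C (Polynomial.C ((q.coeff n).coeff k)) =
    algebraMap R (Polynomial (Polynomial F)) (algebraMap F R ((q.coeff n).coeff k)) := rfl
  rw [this]
  exact isAlgebraic_algebraMap _

theorem trdeg_quotient_paramIdeal {n : ℕ} {A : Matrix (Fin n) (Fin (r + 1)) F}
    {B : Matrix (Fin (r + 1)) (Fin n) F} (hBA : B * A = 1) (hr : 0 < r) :
    Algebra.trdeg F (MvPolynomial (Fin n) F ⧸ paramIdeal A) = 2 := by
  have := isAlgebraic_range_paramHom hBA hr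
  have h1 : Algebra.trdeg F (paramHom A).range = 2 := by
    have h2 := trdeg_add_eq F (paramHom A).range (A := Polynomial (Polynomial F))
    have h3 := trdeg_add_eq F (Polynomial F) (A := Polynomial (Polynomial F))
    rw [Polynomial.trdeg_of_isDomain, Polynomial.trdeg_of_isDomain] at h3
    rw [trdeg_eq_zero (R := (paramHom A).range), add_zero] at h2
    rw [h2, ← h3]
    norm_num
  have h4 := AlgEquiv.trdeg_eq (R := F) (A := MvPolynomial (Fin n) F ⧸ paramIdeal A)
    (A' := (paramHom A).range) (Ideal.quotientKerEquivRange (paramHom A))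
  exact h4.trans h1


theorem natDegree_rowPoly_le (A : Matrix ι (Fin (r + 1)) F) (j : ι) :
    (rowPoly A j).natDegree ≤ r :=
  Polynomial.natDegree_sum_le_of_forall_le _ _ fun i _ =>
    (Polynomial.natDegree_C_mul_X_pow_le _ _).trans (Nat.lt_succ_iff.1 i.2)

theorem aeval_rowPoly_mem_degreeLT (A : Matrix ι (Fin (r + 1)) F) {f : MvPolynomial ι F} {m : ℕ}
    (hf : f.IsHomogeneous m) :
    aeval (rowPoly A) f ∈ Polynomial.degreeLT F (m * r + 1) := by
  rw [Polynomial.mem_degreeLT]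
  refine lt_of_le_of_lt (Polynomial.degree_le_of_natDegree_le
    (aeval_natDegree_le f hf.totalDegree_le _ (natDegree_rowPoly_le A))) ?_
  exact_mod_cast Nat.lt_succ_self _

theorem exists_isHomogeneous_aeval_rowPoly_eq_X_pow [Fintype ι] {A : Matrix ι (Fin (r + 1)) F}
    {B : Matrix (Fin (r + 1)) ι F} (hBA : B * A = 1) (m : ℕ) :
    ∀ k ≤ m * r, ∃ f : MvPolynomial ι F, f.IsHomogeneous m ∧
      aeval (rowPoly A) f = Polynomial.X ^ k := by
  induction m with
  | zero =>
    intro k hk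
    obtain rfl : k = 0 := by simpa using hk
    exact ⟨1, isHomogeneous_one _ _, by simp⟩
  | succ m ih =>
    intro k hk
    -- An exponent `k ≤ (m + 1) r` is peeled greedily: one linear form takes `min k r`, and at most
    -- `m r` remains.
    obtain ⟨f, hf, hfk⟩ := ih (k - min k r) (by rw [Nat.succ_mul] at hk; omega)
    refine ⟨f * rowForm B ⟨min k r, by omega⟩, hf.mul (rowForm_isHomogeneous _ _), ?_⟩
    rw [map_mul, hfk, aeval_rowForm hBA, ← pow_add]
    congr 1
    simp

theorem range_aeval_rowPoly [Fintype ι] {A : Matrix ι (Fin (r + 1)) F}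
    {B : Matrix (Fin (r + 1)) ι F} (hBA : B * A = 1) (m : ℕ) :
    LinearMap.range ((aeval (rowPoly A)).toLinearMap ∘ₗ (homogeneousSubmodule ι F m).subtype) =
      Polynomial.degreeLT F (m * r + 1) := by
  apply le_antisymm
  · rintro _ ⟨f, rfl⟩
    exact aeval_rowPoly_mem_degreeLT A f.2
  · classical
    rw [Polynomial.degreeLT_eq_span_X_pow, Submodule.span_le]
    intro p hp
    simp only [Finset.coe_image, Finset.coe_range, Set.mem_image, Set.mem_Iio] at hp
    obtain ⟨k, hk, rfl⟩ := hp
    obtain ⟨f, hf, hfk⟩ :=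
      exists_isHomogeneous_aeval_rowPoly_eq_X_pow hBA m k (Nat.lt_succ_iff.1 hk)
    exact ⟨⟨f, hf⟩, hfk⟩

/-- In degree `m` the quotient is the image of `f ↦ f(A (1, t, …, tʳ))`, that is, all polynomials of
degree at most `m r`. -/
theorem finrank_homogeneousSubmodule_quotient [Fintype ι] {A : Matrix ι (Fin (r + 1)) F}
    {B : Matrix (Fin (r + 1)) ι F} (hBA : B * A = 1) (m : ℕ) :
    Module.finrank F (homogeneousSubmodule ι F m ⧸
      ((paramIdeal A).restrictScalars F).comap (homogeneousSubmodule ι F m).subtype) =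
      m * r + 1 := by
  have hk : ((paramIdeal A).restrictScalars F).comap (homogeneousSubmodule ι F m).subtype =
      LinearMap.ker ((aeval (rowPoly A)).toLinearMap ∘ₗ
        (homogeneousSubmodule ι F m).subtype) := by
    ext f
    exact mem_paramIdeal_of_isHomogeneous f.2
  rw [hk, (LinearMap.quotKerEquivRange _).finrank_eq, range_aeval_rowPoly hBA,
    Module.finrank_eq_card_basis (Polynomial.degreeLT.basis F (m * r + 1)), Fintype.card_fin]

end CoordinateRing

/-! ### Tangent spaces of the affine cone and smoothness. -/

noncomputable section TangentSpace

variable {F : Type*} [Field F] {ι : Type*} {r : ℕ}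

theorem _root_.MvPolynomial.derivative_aeval [Fintype ι] (γ : ι → Polynomial F)
    (f : MvPolynomial ι F) :
    Polynomial.derivative (aeval γ f) =
      ∑ j, aeval γ (pderiv j f) * Polynomial.derivative (γ j) := by
  classical
  induction f using MvPolynomial.induction_on with
  | C a => simp [MvPolynomial.algHom_C]
  | add p q hp hq => simp only [map_add, hp, hq, add_mul, Finset.sum_add_distrib]
  | mul_X p i hp =>
    have h : ∀ j, aeval γ (pderiv j (p * X i)) * Polynomial.derivative (γ j) =
        aeval γ (pderiv j p) * Polynomial.derivative (γ j) * γ i +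
          if i = j then aeval γ p * Polynomial.derivative (γ j) else 0 := by
      intro j
      rw [pderiv_mul, map_add, map_mul, map_mul, aeval_X, pderiv_X]
      by_cases hij : i = j
      · subst hij
        rw [Pi.single_eq_same, map_one, if_pos rfl]
        ring
      · rw [Pi.single_eq_of_ne hij, map_zero, if_neg hij]
        ring
    rw [map_mul, aeval_X, Polynomial.derivative_mul, hp, Finset.sum_mul]
    simp only [h, Finset.sum_add_distrib, Finset.sum_ite_eq, Finset.mem_univ, if_true]

theorem _root_.MvPolynomial.eval_aeval_polynomial (γ : ι → Polynomial F) (f : MvPolynomial ι F)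
    (x : F) : (aeval γ f).eval x = eval (fun j => (γ j).eval x) f := by
  have h1 := DFunLike.congr_fun (MvPolynomial.comp_aeval γ (Polynomial.aeval (R := F) x)) f
  simp only [AlgHom.comp_apply, Polynomial.coe_aeval_eq_eval] at h1
  rw [h1, ← coe_aeval_eq_eval, RingHom.coe_coe]

/-- Chain rule: `f` vanishes identically along a polynomial arc in the cone, so its gradient is
orthogonal to the velocity. -/
theorem gradient_dotProduct_eq_zero [Infinite F] [Fintype ι] {A : Matrix ι (Fin (r + 1)) F}
    {f : MvPolynomial ι F} (hf : f ∈ paramIdeal A) (Γ : Fin (r + 1) → Polynomial F)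
    (hΓ : ∀ x : F, IsMoment fun i => (Γ i).eval x) (x : F) :
    dotProduct (fun j => eval (A.mulVec fun i => (Γ i).eval x) (pderiv j f))
      (A.mulVec fun i => (Polynomial.derivative (Γ i)).eval x) = 0 := by
  let γ : ι → Polynomial F := fun j => ∑ i, Polynomial.C (A j i) * Γ i
  have hγ : ∀ x, (fun j => (γ j).eval x) = A.mulVec fun i => (Γ i).eval x := by
    intro x
    ext j
    simp [γ, Matrix.mulVec, dotProduct, Polynomial.eval_finsetSum]
  have h0 : aeval γ f = 0 := Polynomial.funext fun x => by
    rw [eval_aeval_polynomial, hγ, eval_mulVec_of_isMoment hf (hΓ x), Polynomial.eval_zero]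
  have h1 := congrArg (Polynomial.eval x) (derivative_aeval γ f)
  rw [h0, Polynomial.derivative_zero, Polynomial.eval_zero, Polynomial.eval_finsetSum] at h1
  rw [h1, dotProduct]
  refine Finset.sum_congr rfl fun j _ => ?_
  rw [Polynomial.eval_mul, eval_aeval_polynomial, hγ]
  congr 1
  simp [γ, Matrix.mulVec, dotProduct, Polynomial.eval_finsetSum]

theorem finrank_add_finrank_dotProduct_orthogonal [Fintype ι] (W : Submodule F (ι → F)) :
    Module.finrank F W +
      Module.finrank F (LinearMap.BilinForm.orthogonal (dotProductBilin F F) W) =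
      Fintype.card ι := by
  classical
  have h := LinearMap.BilinForm.finrank_add_finrank_orthogonal'
    (B := (dotProductBilin F F : LinearMap.BilinForm F (ι → F))) W
  have hker : LinearMap.ker (dotProductBilin F F : LinearMap.BilinForm F (ι → F)) = ⊥ := by
    rw [LinearMap.ker_eq_bot']
    intro v hv
    ext j
    have := DFunLike.congr_fun hv (Pi.single j 1)
    simpa using this
  rw [hker, inf_bot_eq, finrank_bot, add_zero, Module.finrank_fintype_fun_eq_card] at h
  exact h

/-- The span of the gradients, at `v`, of the polynomials of an ideal. -/
def gradientSpan (I : Ideal (MvPolynomial ι F)) (v : ι → F) : Submodule F (ι → F) :=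
  Submodule.span F {w | ∃ f ∈ I, w = fun j => eval v (pderiv j f)}

/-- The orthogonal complement of the gradients is the plane spanned by `A y` and `A y'`. Both
vectors lie in it by `hy` and `hy'`. Conversely, the linear forms force a vector `v` of it to be `A
(B v)`, and the differentiated minors put `z = B v` under `htan`. -/
theorem finrank_gradientSpan_of_tangent [Infinite F] [Fintype ι] {A : Matrix ι (Fin (r + 1)) F}
    {B : Matrix (Fin (r + 1)) ι F} (hBA : B * A = 1) {y y' : Fin (r + 1) → F}
    (hli : LinearIndependent F ![y, y'])
    (hy : ∀ f ∈ paramIdeal A,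
      dotProduct (fun j => eval (A.mulVec y) (pderiv j f)) (A.mulVec y) = 0)
    (hy' : ∀ f ∈ paramIdeal A,
      dotProduct (fun j => eval (A.mulVec y) (pderiv j f)) (A.mulVec y') = 0)
    (htan : ∀ z : Fin (r + 1) → F,
      (∀ i j k l : Fin (r + 1), (i : ℕ) + j = k + l →
        z i * y j + y i * z j = z k * y l + y k * z l) → ∃ a b : F, z = a • y + b • y') :
    Module.finrank F (gradientSpan (paramIdeal A) (A.mulVec y)) + 2 = Fintype.card ι := by
  rw [← finrank_add_finrank_dotProduct_orthogonal (gradientSpan (paramIdeal A) (A.mulVec y))]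
  congr 1
  have hinj : Function.Injective A.mulVecLin := by
    intro u v huv
    have := congrArg B.mulVec huv
    simpa [Matrix.mulVec_mulVec, hBA] using this
  have hpair : Set.range (⇑A.mulVecLin ∘ ![y, y']) = {A.mulVec y, A.mulVec y'} := by
    rw [Set.range_comp, Matrix.range_cons_cons_empty, Set.image_pair]
    rfl
  have hspan : LinearMap.BilinForm.orthogonal (dotProductBilin F F)
      (gradientSpan (paramIdeal A) (A.mulVec y)) =
      Submodule.span F (Set.range (⇑A.mulVecLin ∘ ![y, y'])) := by
    rw [hpair]
    ext v
    rw [LinearMap.BilinForm.mem_orthogonal_iff, Submodule.mem_span_pair]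
    constructor
    · intro h
      have hgrad : ∀ f ∈ paramIdeal A,
          dotProduct (fun j => eval (A.mulVec y) (pderiv j f)) v = 0 := fun f hf =>
        h _ (Submodule.subset_span ⟨f, hf, rfl⟩)
      have hform : ∀ (w : ι → F) (u : ι → F),
          (fun j => eval u (pderiv j (∑ k, C (w k) * X k : MvPolynomial ι F))) = w := by
        classical
        intro w u
        ext j
        simp [map_sum, pderiv_X, Pi.single_apply]
      have hv : A.mulVec (B.mulVec v) = v := mulVec_mulVec_of_annihilated hBA fun w hw => by
        have := hgrad _ (linear_mem_paramIdeal hw)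
        rwa [hform] at this
      have hBy : B.mulVec (A.mulVec y) = y := by simp [Matrix.mulVec_mulVec, hBA]
      obtain ⟨a, b, hab⟩ := htan (B.mulVec v) fun i j k l hijkl => by
        have h1 := hgrad _ (minor_mem_paramIdeal hBA hijkl)
        have h2 : ∀ i : Fin (r + 1),
            ∑ m, eval (A.mulVec y) (pderiv m (rowForm B i)) * v m = B.mulVec v i := by
          intro i
          exact congrArg (fun w => dotProduct w v) (hform (B i) (A.mulVec y))
        simp only [dotProduct, map_sub, pderiv_mul, map_add, map_mul, eval_rowForm, hBy, sub_mul,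
          add_mul, Finset.sum_sub_distrib, Finset.sum_add_distrib] at h1
        have h3 : ∀ i j : Fin (r + 1), ∑ m, eval (A.mulVec y) (pderiv m (rowForm B i)) * y j * v m
            = B.mulVec v i * y j := by
          intro i j
          rw [← h2, Finset.sum_mul]
          exact Finset.sum_congr rfl fun _ _ => by ring
        have h4 : ∀ i j : Fin (r + 1), ∑ m, y i * eval (A.mulVec y) (pderiv m (rowForm B j)) * v m
            = y i * B.mulVec v j := by
          intro i j
          rw [← h2, Finset.mul_sum]
          exact Finset.sum_congr rfl fun _ _ => by ring
        rw [h3, h3, h4, h4] at h1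
        exact sub_eq_zero.1 h1
      refine ⟨a, b, ?_⟩
      rw [← hv, hab, Matrix.mulVec_add, Matrix.mulVec_smul, Matrix.mulVec_smul]
    · rintro ⟨a, b, rfl⟩ w hw
      change dotProduct w _ = 0
      induction hw using Submodule.span_induction with
      | mem w hw =>
        obtain ⟨f, hf, rfl⟩ := hw
        rw [dotProduct_add, dotProduct_smul, dotProduct_smul, hy f hf, hy' f hf]
        simp
      | zero => simp
      | add u v _ _ hu hv => rw [add_dotProduct, hu, hv, add_zero]
      | smul c u _ hu => rw [smul_dotProduct, hu, smul_zero]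
  rw [hspan, finrank_span_eq_card, Fintype.card_fin]
  exact hli.map' _ (LinearMap.ker_eq_bot.2 hinj)

/-- Euler's relation, from the arc `x ↦ x • y` at `x = 1`. -/
theorem euler_tangent [Infinite F] [Fintype ι] {A : Matrix ι (Fin (r + 1)) F} {y : Fin (r + 1) → F}
    (hy : IsMoment y) {f : MvPolynomial ι F} (hf : f ∈ paramIdeal A) :
    dotProduct (fun j => eval (A.mulVec y) (pderiv j f)) (A.mulVec y) = 0 := by
  have h := gradient_dotProduct_eq_zero hf (fun i => Polynomial.C (y i) * Polynomial.X)
    (fun x => by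
      simp only [Polynomial.eval_mul, Polynomial.eval_C, Polynomial.eval_X, mul_comm _ x]
      exact hy.smul x) 1
  simpa only [Polynomial.eval_mul, Polynomial.eval_C, Polynomial.eval_X, mul_one,
    Polynomial.derivative_C_mul, Polynomial.derivative_X] using h

/-- The linearized minors with indices `(i + 1, 0; i, 1)` are a recurrence determining `z` from `z
0` and `z 1`. The two directions are the cone point and its derivative in `t`. -/
theorem exists_eq_add_smul_of_tangent (hr : 0 < r) {c t : F} (hc : c ≠ 0)
    {z : Fin (r + 1) → F}
    (hz : ∀ i j k l : Fin (r + 1), (i : ℕ) + j = k + l →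
      z i * (c * t ^ (j : ℕ)) + (c * t ^ (i : ℕ)) * z j =
        z k * (c * t ^ (l : ℕ)) + (c * t ^ (k : ℕ)) * z l) :
    ∃ a b : F, z = a • (fun i : Fin (r + 1) => c * t ^ (i : ℕ)) +
      b • fun i : Fin (r + 1) => c * ((i : ℕ) * t ^ ((i : ℕ) - 1)) := by
  set z0 := z 0 with hz0
  set z1 := z ⟨1, by omega⟩ with hz1
  refine ⟨z0 / c, (z1 - t * z0) / c, ?_⟩
  have key : ∀ i : ℕ, ∀ hi : i < r + 1,
      z ⟨i, hi⟩ = z0 * t ^ i + (z1 - t * z0) * (i * t ^ (i - 1)) := by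
    intro i
    induction i with
    | zero => intro hi; simp [hz0]
    | succ i ih =>
      intro hi
      have h := hz ⟨i + 1, hi⟩ 0 ⟨i, by omega⟩ ⟨1, by omega⟩ (by simp)
      rw [ih (by omega), ← hz0, ← hz1] at h
      simp only [Fin.val_zero, pow_zero, mul_one] at h
      have h2 : z ⟨i + 1, hi⟩ + t ^ (i + 1) * z0 =
          (z0 * t ^ i + (z1 - t * z0) * (i * t ^ (i - 1))) * t + t ^ i * z1 := by
        apply mul_left_cancel₀ hc
        linear_combination h
      -- The truncated exponent `i - 1` at `i = 0` is harmless, its factor `i` being zero.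
      rcases i with _ | i
      · simp at h2 ⊢
        linear_combination h2
      · simp only [Nat.add_sub_cancel] at h2 ⊢
        push_cast at h2 ⊢
        linear_combination h2
  ext i
  rw [show z i = _ from key i i.2]
  simp only [Pi.add_apply, Pi.smul_apply, smul_eq_mul]
  field_simp

theorem exists_eq_add_smul_of_tangent_single (hr : 0 < r) {c : F} (hc : c ≠ 0)
    {z : Fin (r + 1) → F}
    (hz : ∀ i j k l : Fin (r + 1), (i : ℕ) + j = k + l →
      z i * (Pi.single (Fin.last r) c : Fin (r + 1) → F) j +
          (Pi.single (Fin.last r) c : Fin (r + 1) → F) i * z j =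
        z k * (Pi.single (Fin.last r) c : Fin (r + 1) → F) l +
          (Pi.single (Fin.last r) c : Fin (r + 1) → F) k * z l) :
    ∃ a b : F, z = a • (Pi.single (Fin.last r) c : Fin (r + 1) → F) +
      b • (Pi.single ⟨r - 1, by omega⟩ c : Fin (r + 1) → F) := by
  refine ⟨z (Fin.last r) / c, z ⟨r - 1, by omega⟩ / c, ?_⟩
  ext i
  simp only [Pi.add_apply, Pi.smul_apply, smul_eq_mul]
  by_cases h1 : i = Fin.last r
  · subst h1
    have : Fin.last r ≠ ⟨r - 1, by omega⟩ := fun h => by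
      have := congrArg Fin.val h
      simp at this
      omega
    rw [Pi.single_eq_same, Pi.single_eq_of_ne this]
    field_simp
    simp
  by_cases h2 : i = ⟨r - 1, by omega⟩
  · subst h2
    rw [Pi.single_eq_same, Pi.single_eq_of_ne h1]
    field_simp
    simp
  rw [Pi.single_eq_of_ne h1, Pi.single_eq_of_ne h2]
  have hi : (i : ℕ) + 1 < r := by
    have h3 := Fin.val_lt_last h1
    have h4 : (i : ℕ) ≠ r - 1 := fun h => h2 (Fin.ext h)
    omega
  -- In this relation the three terms other than `z i * c` contain a vanishing coordinate of the
  -- point at infinity, so `z i = 0`.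
  have h := hz i (Fin.last r) ⟨i + 1, by omega⟩ ⟨r - 1, by omega⟩ (by simp; omega)
  have e1 : (⟨i + 1, by omega⟩ : Fin (r + 1)) ≠ Fin.last r := fun h => by
    have := congrArg Fin.val h; simp at this; omega
  have e2 : (⟨r - 1, by omega⟩ : Fin (r + 1)) ≠ Fin.last r := fun h => by
    have := congrArg Fin.val h; simp at this; omega
  rw [Pi.single_eq_same, Pi.single_eq_of_ne h1, Pi.single_eq_of_ne e1,
    Pi.single_eq_of_ne e2] at h
  simp only [mul_zero, zero_mul, add_zero, mul_eq_zero, hc, or_false] at h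
  simp [h]

theorem single_last_eq_mul_zero_pow (c : F) (i : Fin (r + 1)) :
    (Pi.single (Fin.last r) c : Fin (r + 1) → F) i = c * 0 ^ (r - (i : ℕ)) := by
  by_cases hi : i = Fin.last r
  · subst hi; simp
  · have : r - (i : ℕ) ≠ 0 := by have := Fin.val_lt_last hi; omega
    simp [hi, this]

theorem finrank_gradientSpan [Infinite F] [Fintype ι] (hr : 0 < r) {A : Matrix ι (Fin (r + 1)) F}
    {B : Matrix (Fin (r + 1)) ι F} (hBA : B * A = 1) {y : Fin (r + 1) → F} (hy : IsMoment y)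
    (hy0 : y ≠ 0) :
    Module.finrank F (gradientSpan (paramIdeal A) (A.mulVec y)) + 2 = Fintype.card ι := by
  have heuler := fun f (hf : f ∈ paramIdeal A) => euler_tangent hy hf
  rcases hy with ⟨c, t, rfl⟩ | ⟨c, rfl⟩
  · have hc : c ≠ 0 := by
      rintro rfl
      exact hy0 (by ext; simp)
    refine finrank_gradientSpan_of_tangent hBA ?_ heuler (fun f hf => ?_)
      (fun z hz => exists_eq_add_smul_of_tangent hr hc hz)
    · rw [LinearIndependent.pair_iff]
      intro a b hab
      have h0 := congrFun hab 0
      have h1 := congrFun hab ⟨1, by omega⟩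
      simp [hc] at h0
      simp [hc, h0] at h1
      exact ⟨h0, h1⟩
    · have h := gradient_dotProduct_eq_zero hf
        (fun i => Polynomial.C c * Polynomial.X ^ (i : ℕ))
        (fun x => Or.inl ⟨c, x, by simp⟩) t
      simpa [Polynomial.derivative_X_pow] using h
  · have hc : c ≠ 0 := by
      rintro rfl
      exact hy0 (by simp)
    refine finrank_gradientSpan_of_tangent hBA ?_ heuler (fun f hf => ?_)
      (fun z hz => exists_eq_add_smul_of_tangent_single hr hc hz)
    · rw [LinearIndependent.pair_iff]
      intro a b hab
      have h0 := congrFun hab (Fin.last r)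
      have h1 := congrFun hab ⟨r - 1, by omega⟩
      have e2 : (⟨r - 1, by omega⟩ : Fin (r + 1)) ≠ Fin.last r := fun h => by
        have := congrArg Fin.val h; simp at this; omega
      simp [Pi.single_eq_of_ne e2.symm, hc] at h0
      simp [Pi.single_eq_of_ne e2, hc] at h1
      exact ⟨h0, h1⟩
    -- Near infinity the arc is `x ↦ c x^(r - i)`. At `x = 0` it passes through the point, with
    -- velocity concentrated in coordinate `r - 1`.
    · have h := gradient_dotProduct_eq_zero hf
        (fun i => Polynomial.C c * Polynomial.X ^ (r - (i : ℕ))) (fun x => ?_) 0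
      · convert h using 3
        · congr 3
          ext i
          simpa using single_last_eq_mul_zero_pow c i
        · ext i
          by_cases hi : i = ⟨r - 1, by omega⟩
          · subst hi
            have : r - (r - 1) = 1 := by omega
            simp [this]
          · rw [Pi.single_eq_of_ne hi]
            have h3 : (i : ℕ) ≠ r - 1 := fun h => hi (Fin.ext h)
            by_cases h4 : r - (i : ℕ) = 0
            · simp [h4]
            · have h5 : r - (i : ℕ) - 1 ≠ 0 := by omega
              simp [Polynomial.derivative_X_pow, h5]
      · by_cases hx : x = 0
        · right
          refine ⟨c, ?_⟩
          subst hx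
          ext i
          simpa using (single_last_eq_mul_zero_pow c i).symm
        · left
          refine ⟨c * x ^ r, x⁻¹, ?_⟩
          ext i
          have hi : (i : ℕ) ≤ r := by omega
          simp [pow_sub₀ x hx hi, mul_assoc]

end TangentSpace

/-! ### The projective curve: regularity, Hilbert function, hyperplane sections and degree. -/

noncomputable section ProjectiveCurve

variable {F : Type*} [Field F]

/-- The polynomial of degree at most `r` with the given coefficients. -/
def coeffPoly {R : Type*} [CommRing R] {r : ℕ} (e : Fin (r + 1) → R) : Polynomial R :=
  ∑ i, Polynomial.C (e i) * Polynomial.X ^ (i : ℕ)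

theorem coeff_coeffPoly {R : Type*} [CommRing R] {r : ℕ} (e : Fin (r + 1) → R)
    (i : Fin (r + 1)) : (coeffPoly e).coeff i = e i := by
  simp only [coeffPoly, Polynomial.finsetSum_coeff, Polynomial.coeff_C_mul, Polynomial.coeff_X_pow]
  rw [Finset.sum_eq_single i]
  · simp
  · intro j _ hj
    simp [Fin.val_inj, hj.symm]
  · simp

theorem natDegree_coeffPoly_le {R : Type*} [CommRing R] {r : ℕ} (e : Fin (r + 1) → R) :
    (coeffPoly e).natDegree ≤ r :=
  Polynomial.natDegree_sum_le_of_forall_le _ _ fun i _ =>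
    (Polynomial.natDegree_C_mul_X_pow_le _ _).trans (Nat.lt_succ_iff.1 i.2)

theorem natDegree_coeffPoly {R : Type*} [CommRing R] {r : ℕ} {e : Fin (r + 1) → R}
    (he : e (Fin.last r) ≠ 0) : (coeffPoly e).natDegree = r :=
  Polynomial.natDegree_eq_of_le_of_coeff_ne_zero (natDegree_coeffPoly_le e) (by
    have := coeff_coeffPoly e (Fin.last r)
    rw [Fin.val_last] at this
    rwa [this])

theorem map_coeffPoly {R S : Type*} [CommRing R] [CommRing S] {r : ℕ} (φ : R →+* S)
    (e : Fin (r + 1) → R) : (coeffPoly e).map φ = coeffPoly fun i => φ (e i) := by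
  simp [coeffPoly, Polynomial.map_sum]

theorem eval_coeffPoly {r : ℕ} (e : Fin (r + 1) → F) (t : F) :
    (coeffPoly e).eval t = dotProduct e fun i => t ^ (i : ℕ) := by
  simp [coeffPoly, Polynomial.eval_finsetSum, dotProduct]

theorem _root_.MvPolynomial.IsHomogeneous.det {R σ κ : Type*} [CommRing R] [Fintype κ]
    [DecidableEq κ] {M : Matrix κ κ (MvPolynomial σ R)} {d : ℕ}
    (hM : ∀ i j, (M i j).IsHomogeneous d) : M.det.IsHomogeneous (Fintype.card κ * d) := by
  rw [Matrix.det_apply']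
  refine IsHomogeneous.sum _ _ _ fun τ _ => ?_
  have h1 : (((Equiv.Perm.sign τ : ℤ) : MvPolynomial σ R)).IsHomogeneous 0 := by
    have : (((Equiv.Perm.sign τ : ℤ) : MvPolynomial σ R)) = C ((Equiv.Perm.sign τ : ℤ) : R) := by
      simp
    rw [this]
    exact isHomogeneous_C _ _
  have h2 := IsHomogeneous.prod Finset.univ (fun i => M (τ i) i) (fun _ => d)
    fun i _ => hM (τ i) i
  have h3 := h1.mul h2
  simpa using h3

/-- The discriminant locus of polynomials of degree `r` is a hypersurface. -/
theorem exists_isHomogeneous_separable [CharZero F] {r : ℕ} (hr : 0 < r) :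
    ∃ G : MvPolynomial (Fin (r + 1)) F, G.IsHomogeneous (1 + (r + (r - 1))) ∧
      (∃ e, eval e G ≠ 0) ∧
      ∀ e, eval e G ≠ 0 → e (Fin.last r) ≠ 0 ∧ (coeffPoly e).Separable := by
  let H : Polynomial (MvPolynomial (Fin (r + 1)) F) := coeffPoly X
  -- The factor `X (Fin.last r)` forces the degree to be exactly `r`; in characteristic zero the
  -- derivative then has degree `r - 1`, so the resultant taken in these formal degrees detects
  -- separability.
  let G : MvPolynomial (Fin (r + 1)) F :=
    X (Fin.last r) * Polynomial.resultant H (Polynomial.derivative H) r (r - 1)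
  have hG : ∀ e, eval e G = e (Fin.last r) *
      Polynomial.resultant (coeffPoly e) (Polynomial.derivative (coeffPoly e)) r (r - 1) := by
    intro e
    have h1 : H.map (eval e) = coeffPoly e := by
      simp only [H, map_coeffPoly, eval_X]
    rw [map_mul, eval_X, ← Polynomial.resultant_map_map, ← Polynomial.derivative_map, h1]
  have hsep : ∀ e : Fin (r + 1) → F, e (Fin.last r) ≠ 0 →
      (Polynomial.resultant (coeffPoly e) (Polynomial.derivative (coeffPoly e)) r (r - 1) ≠ 0 ↔
        (coeffPoly e).Separable) := by
    intro e he
    have h1 := natDegree_coeffPoly he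
    have h2 := Polynomial.natDegree_derivative (coeffPoly e)
    have h3 := Polynomial.resultant_eq_zero_iff (f := coeffPoly e)
      (g := Polynomial.derivative (coeffPoly e))
    rw [h2, h1] at h3
    have h4 : coeffPoly e ≠ 0 := by
      intro h
      rw [h, Polynomial.natDegree_zero] at h1
      omega
    rw [Ne, h3, Polynomial.Separable]
    simp [h4]
  refine ⟨G, ?_, ?_, fun e he => ?_⟩
  · refine (isHomogeneous_X _ _).mul ?_
    have hcoeff : ∀ k, (H.coeff k).IsHomogeneous 1 := by
      intro k
      simp only [H, coeffPoly, Polynomial.finsetSum_coeff]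
      refine IsHomogeneous.sum _ _ _ fun i _ => ?_
      rw [Polynomial.coeff_C_mul_X_pow]
      split_ifs
      · exact isHomogeneous_X _ _
      · exact isHomogeneous_zero _ _ _
    have hcoeff' : ∀ k, ((Polynomial.derivative H).coeff k).IsHomogeneous 1 := by
      intro k
      rw [Polynomial.coeff_derivative]
      have h1 : ((k : MvPolynomial (Fin (r + 1)) F) + 1) = C ((k : F) + 1) := by simp
      rw [h1]
      exact (hcoeff _).mul (isHomogeneous_C _ _)
    have h := IsHomogeneous.det (d := 1)
      (M := Polynomial.sylvester H (Polynomial.derivative H) r (r - 1)) (fun i j => by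
        refine Fin.addCases (fun j => ?_) (fun j => ?_) j
        · simp only [Polynomial.sylvester, Matrix.of_apply, Fin.addCases_left]
          split_ifs
          · exact hcoeff' _
          · exact isHomogeneous_zero _ _ _
        · simp only [Polynomial.sylvester, Matrix.of_apply, Fin.addCases_right]
          split_ifs
          · exact hcoeff _
          · exact isHomogeneous_zero _ _ _)
    rwa [Fintype.card_fin, mul_one] at h
  -- The separable polynomial `Xʳ - 1` shows that `G` does not vanish identically.
  · let e : Fin (r + 1) → F := Pi.single (Fin.last r) 1 - Pi.single 0 1
    have h0 : (0 : Fin (r + 1)) ≠ Fin.last r := fun h => by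
      have := congrArg Fin.val h
      simp at this
      omega
    have he : e (Fin.last r) ≠ 0 := by simp [e, Pi.single_eq_of_ne h0.symm]
    refine ⟨e, ?_⟩
    rw [hG]
    refine mul_ne_zero he ((hsep e he).2 ?_)
    have h1 : coeffPoly e = Polynomial.X ^ r - 1 := by
      simp only [coeffPoly, e, Pi.sub_apply, map_sub, sub_mul, Finset.sum_sub_distrib]
      congr 1
      · rw [Finset.sum_eq_single (Fin.last r)] <;> simp +contextual
      · rw [Finset.sum_eq_single 0] <;> simp +contextual
    rw [h1]
    have : NeZero (r : F) := ⟨by exact_mod_cast hr.ne'⟩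
    exact Polynomial.X_pow_sub_one_separable_iff.2 (NeZero.ne _)
  · rw [hG] at he
    have h1 := left_ne_zero_of_mul he
    exact ⟨h1, (hsep e h1).1 (right_ne_zero_of_mul he)⟩

variable {N r : ℕ} {Z : Set (ℙ F (Fin (N + 1) → F))} {A : Matrix (Fin (N + 1)) (Fin (r + 1)) F}
  {B : Matrix (Fin (r + 1)) (Fin (N + 1)) F}

theorem subset_zariskiClosure (Z : Set (ℙ F (Fin (N + 1) → F))) : Z ⊆ zariskiClosure Z := by
  intro p hp f hf
  induction hf using Submodule.span_induction with
  | mem f hf => exact hf.2 p hp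
  | zero => simp
  | add f g _ _ hf hg => rw [map_add, hf, hg, add_zero]
  | smul a f _ hf => rw [smul_eq_mul, map_mul, hf, mul_zero]

theorem homogeneousIdeal_zariskiClosure (Z : Set (ℙ F (Fin (N + 1) → F))) :
    homogeneousIdeal (zariskiClosure Z) = homogeneousIdeal Z := by
  apply le_antisymm
  · exact Ideal.span_mono fun f hf => ⟨hf.1, fun p hp => hf.2 p (subset_zariskiClosure Z hp)⟩
  · exact Ideal.span_mono fun f hf => ⟨hf.1, fun p hp => hp f (Ideal.subset_span hf)⟩

theorem zariskiClosure_zariskiClosure (Z : Set (ℙ F (Fin (N + 1) → F))) :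
    zariskiClosure (zariskiClosure Z) = zariskiClosure Z := by
  conv_lhs => rw [zariskiClosure]
  rw [homogeneousIdeal_zariskiClosure]
  rfl

theorem mem_iff_of_homogeneousIdeal_eq [Infinite F] (hcl : zariskiClosure Z = Z)
    (hI : homogeneousIdeal Z = paramIdeal A) (hBA : B * A = 1) (p : ℙ F (Fin (N + 1) → F)) :
    p ∈ Z ↔ ∃ y, IsMoment y ∧ p.rep = A.mulVec y := by
  conv_lhs => rw [← hcl]
  rw [← zeroLocus_paramIdeal hBA, ← hI]
  rfl

theorem isProjectiveCurve_of_homogeneousIdeal_eq (hr : 0 < r) (hcl : zariskiClosure Z = Z)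
    (hI : homogeneousIdeal Z = paramIdeal A) (hBA : B * A = 1) : IsProjectiveCurve Z where
  isClosed := hcl
  isPrime := hI ▸ isPrime_paramIdeal A
  trdeg := by
    rw [hI]
    exact trdeg_quotient_paramIdeal hBA hr

theorem isRegularCurve_of_homogeneousIdeal_eq [Infinite F] (hr : 0 < r)
    (hcl : zariskiClosure Z = Z) (hI : homogeneousIdeal Z = paramIdeal A) (hBA : B * A = 1) :
    IsRegularCurve Z := by
  refine ⟨isProjectiveCurve_of_homogeneousIdeal_eq hr hcl hI hBA, fun p hp => ?_⟩
  obtain ⟨y, hy, hpy⟩ := (mem_iff_of_homogeneousIdeal_eq hcl hI hBA p).1 hp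
  have hy0 : y ≠ 0 := by
    rintro rfl
    exact p.rep_nonzero (by rw [hpy, Matrix.mulVec_zero])
  have h := finrank_gradientSpan hr hBA hy hy0
  rw [← hpy, ← hI, Fintype.card_fin] at h
  exact Nat.succ_injective h

theorem hilbertFunction_of_homogeneousIdeal_eq (hI : homogeneousIdeal Z = paramIdeal A)
    (hBA : B * A = 1) (m : ℕ) : hilbertFunction Z m = m * r + 1 := by
  rw [hilbertFunction, hI]
  exact finrank_homogeneousSubmodule_quotient hBA m

theorem mulVec_ne_zero_of_mul_eq_one (hBA : B * A = 1) {y : Fin (r + 1) → F} (hy : y ≠ 0) :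
    A.mulVec y ≠ 0 := by
  intro h
  apply hy
  have := congrArg B.mulVec h
  simpa [Matrix.mulVec_mulVec, hBA] using this

theorem powers_ne_zero (t : F) : (fun i : Fin (r + 1) => t ^ (i : ℕ)) ≠ 0 := fun h => by
  simpa using congrFun h 0

/-- Pulled back along `t ↦ A (1, t, …, tʳ)`, the hyperplane becomes the polynomial with coefficients
`c A`. Its top coefficient is the value at the point at infinity; `hc` keeps that point off the
hyperplane. -/
theorem hyperplane_inter_eq_image [Infinite F] (hcl : zariskiClosure Z = Z)
    (hI : homogeneousIdeal Z = paramIdeal A) (hBA : B * A = 1) {c : Fin (N + 1) → F}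
    (hc : Matrix.vecMul c A (Fin.last r) ≠ 0) :
    Z ∩ hyperplane c = (fun t => Projectivization.mk F (A.mulVec fun i => t ^ (i : ℕ))
        (mulVec_ne_zero_of_mul_eq_one hBA (powers_ne_zero t))) ''
      ((coeffPoly (Matrix.vecMul c A)).rootSet F) := by
  have h0 : coeffPoly (Matrix.vecMul c A) ≠ 0 := by
    intro h
    apply hc
    rw [← coeff_coeffPoly (Matrix.vecMul c A), h, Polynomial.coeff_zero]
  ext p
  simp only [Set.mem_inter_iff, Set.mem_image, Polynomial.mem_rootSet, ne_eq, h0,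
    not_false_eq_true, true_and, Polynomial.coe_aeval_eq_eval, eval_coeffPoly,
    mem_iff_of_homogeneousIdeal_eq hcl hI hBA]
  constructor
  · rintro ⟨⟨y, hy, hpy⟩, hp⟩
    have hp' : dotProduct c p.rep = 0 := hp
    have hy0 : y ≠ 0 := by
      rintro rfl
      exact p.rep_nonzero (by rw [hpy, Matrix.mulVec_zero])
    rw [hpy, Matrix.dotProduct_mulVec] at hp'
    rcases hy with ⟨d, t, rfl⟩ | ⟨d, rfl⟩
    · have hd : d ≠ 0 := by
        rintro rfl
        exact hy0 (by ext; simp)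
      have hdt : (fun i : Fin (r + 1) => d * t ^ (i : ℕ)) = d • fun i : Fin (r + 1) => t ^ (i : ℕ) :=
        rfl
      rw [hdt] at hp' hpy
      refine ⟨t, ?_, ?_⟩
      · rw [dotProduct_smul, smul_eq_mul] at hp'
        exact (mul_eq_zero.1 hp').resolve_left hd
      · rw [← p.mk_rep, Projectivization.mk_eq_mk_iff']
        exact ⟨d⁻¹, by rw [hpy, Matrix.mulVec_smul, smul_smul, inv_mul_cancel₀ hd, one_smul]⟩
    · exfalso
      rw [dotProduct_single] at hp'
      rcases mul_eq_zero.1 hp' with h | h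
      · exact hc h
      · exact hy0 (by rw [h, Pi.single_zero])
  · rintro ⟨t, ht, rfl⟩
    obtain ⟨a, ha⟩ := Projectivization.exists_smul_eq_mk_rep F
      (A.mulVec fun i : Fin (r + 1) => t ^ (i : ℕ))
      (mulVec_ne_zero_of_mul_eq_one hBA (powers_ne_zero t))
    constructor
    · refine ⟨(a : F) • fun i : Fin (r + 1) => t ^ (i : ℕ), Or.inl ⟨a, t, rfl⟩, ?_⟩
      rw [← ha, Matrix.mulVec_smul]
      rfl
    · change dotProduct c _ = 0
      rw [← ha, Units.smul_def, dotProduct_smul, Matrix.dotProduct_mulVec, ht, smul_zero]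

theorem mk_mulVec_powers_injective (hr : 0 < r) (hBA : B * A = 1) :
    Function.Injective fun t : F => Projectivization.mk F (A.mulVec fun i => t ^ (i : ℕ))
      (mulVec_ne_zero_of_mul_eq_one hBA (powers_ne_zero t)) := by
  intro s t hst
  simp only [Projectivization.mk_eq_mk_iff'] at hst
  obtain ⟨a, ha⟩ := hst
  have h1 := congrArg B.mulVec ha
  simp only [Matrix.mulVec_smul, Matrix.mulVec_mulVec, hBA, Matrix.one_mulVec] at h1
  have h2 := congrFun h1 0
  have h3 := congrFun h1 ⟨1, by omega⟩
  simp at h2 h3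
  rw [h2, one_mul] at h3
  exact h3.symm

theorem hasDegree_of_homogeneousIdeal_eq [IsAlgClosed F] [CharZero F] (hr : 0 < r)
    (hcl : zariskiClosure Z = Z) (hI : homogeneousIdeal Z = paramIdeal A) (hBA : B * A = 1) :
    HasDegree Z r := by
  obtain ⟨G, hG, ⟨e, he⟩, hsep⟩ := exists_isHomogeneous_separable (F := F) hr
  let G' : MvPolynomial (Fin (N + 1)) F := aeval (rowForm A.transpose) G
  have hG' : ∀ c, eval c G' = eval (Matrix.vecMul c A) G := by
    intro c
    have h1 : (eval c).comp (aeval (rowForm A.transpose) : _ →ₐ[F] _).toRingHom =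
        eval (Matrix.vecMul c A) := by
      refine MvPolynomial.ringHom_ext (fun a => by simp) fun i => ?_
      simp only [RingHom.comp_apply, AlgHom.toRingHom_eq_coe, RingHom.coe_coe, aeval_X,
        eval_rowForm, eval_X, Matrix.mulVec_transpose]
    exact RingHom.congr_fun h1 G
  refine ⟨G', fun h => ?_, ⟨_, hG.aeval _ (rowForm_isHomogeneous _)⟩, fun c _ hc => ?_⟩
  -- Since `B * A = 1`, the hyperplane `e B` pulls back to `e`, where `G` is nonzero.
  · have h1 := hG' (Matrix.vecMul e B)
    rw [Matrix.vecMul_vecMul, hBA, Matrix.vecMul_one, h, map_zero] at h1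
    exact he h1.symm
  · rw [hG'] at hc
    obtain ⟨h1, h2⟩ := hsep _ hc
    rw [hyperplane_inter_eq_image hcl hI hBA h1,
      (mk_mulVec_powers_injective hr hBA).encard_image, ← Set.coe_fintypeCard,
      Polynomial.card_rootSet_eq_natDegree h2 (IsAlgClosed.splits _), natDegree_coeffPoly h1]

end ProjectiveCurve

/-! ### From the affine curve to its homogeneous ideal and its linear span. -/

noncomputable section AffineCurve

variable {F : Type*} [Field F] {n r : ℕ}

/-- The points `(p₀(t)/q(t), …, pₙ₋₁(t)/q(t))`, where the coefficients of `p₀, …, pₙ₋₁, q` are the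
rows of `A`. -/
def rationalPoints (A : Matrix (Fin (n + 1)) (Fin (r + 1)) F) : Set (Fin n → F) :=
  {x | ∃ t : F, (rowPoly A (Fin.last n)).eval t ≠ 0 ∧
    ∀ i, x i = (rowPoly A (Fin.castSucc i)).eval t / (rowPoly A (Fin.last n)).eval t}

theorem mulVec_powers_eq_smul_snoc {A : Matrix (Fin (n + 1)) (Fin (r + 1)) F} {t : F}
    (ht : (rowPoly A (Fin.last n)).eval t ≠ 0) :
    (A.mulVec fun i => t ^ (i : ℕ)) = (rowPoly A (Fin.last n)).eval t •
      (Fin.snoc (fun i => (rowPoly A (Fin.castSucc i)).eval t / (rowPoly A (Fin.last n)).eval t) 1 :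
        Fin (n + 1) → F) := by
  ext j
  refine Fin.lastCases ?_ (fun i => ?_) j
  · simp [← eval_rowPoly]
  · simp [← eval_rowPoly, mul_div_cancel₀ _ ht]

theorem _root_.MvPolynomial.IsHomogeneous.eval_rep_mk_eq_zero_iff {ι : Type*}
    {f : MvPolynomial ι F} {m : ℕ} (hf : f.IsHomogeneous m) {v : ι → F} (hv : v ≠ 0) :
    eval (Projectivization.mk F v hv).rep f = 0 ↔ eval v f = 0 := by
  obtain ⟨a, ha⟩ := Projectivization.exists_smul_eq_mk_rep F v hv
  rw [← ha, Units.smul_def, hf.eval_smul]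
  simp

theorem eval_aeval_snoc (f : MvPolynomial (Fin (n + 1)) F) (x : Fin n → F) :
    eval x (aeval (Fin.snoc X 1 : Fin (n + 1) → MvPolynomial (Fin n) F) f) =
      eval (Fin.snoc x 1 : Fin (n + 1) → F) f := by
  have h : (eval x).comp
      (aeval (Fin.snoc X 1 : Fin (n + 1) → MvPolynomial (Fin n) F) : _ →ₐ[F] _).toRingHom =
      eval (Fin.snoc x 1 : Fin (n + 1) → F) := by
    refine MvPolynomial.ringHom_ext (fun a => by simp) fun j => ?_
    refine Fin.lastCases ?_ (fun i => ?_) j <;> simp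
  exact RingHom.congr_fun h f

theorem infinite_setOf_eval_ne_zero [Infinite F] {q : Polynomial F} (hq : q ≠ 0) :
    {t : F | q.eval t ≠ 0}.Infinite := by
  have h : {t : F | q.IsRoot t}.Finite := by
    by_contra h
    exact hq (Polynomial.eq_zero_of_infinite_isRoot q h)
  exact h.infinite_compl

/-- For homogeneous `f`, vanishing at the parametrized points means that `f(A (1, t, …, tʳ))`
vanishes wherever the denominator does not, hence identically. Neither closure changes this:
dehomogenizing `f` carries its vanishing to the affine closure. -/
theorem homogeneousIdeal_projectiveClosure [Infinite F]
    {A : Matrix (Fin (n + 1)) (Fin (r + 1)) F} (hA : rowPoly A (Fin.last n) ≠ 0) :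
    homogeneousIdeal (projectiveClosure (zeroLocus F (vanishingIdeal F (rationalPoints A)))) =
      paramIdeal A := by
  rw [projectiveClosure, homogeneousIdeal_zariskiClosure]
  have key : ∀ (f : MvPolynomial (Fin (n + 1)) F) (m : ℕ), f.IsHomogeneous m → ∀ t : F,
      (rowPoly A (Fin.last n)).eval t ≠ 0 → ((aeval (rowPoly A) f).eval t = 0 ↔
        eval (Fin.snoc (fun i => (rowPoly A (Fin.castSucc i)).eval t /
          (rowPoly A (Fin.last n)).eval t) 1 : Fin (n + 1) → F) f = 0) := by
    intro f m hf t ht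
    rw [eval_aeval_polynomial]
    simp only [eval_rowPoly]
    have h1 := mulVec_powers_eq_smul_snoc ht
    simp only [eval_rowPoly] at h1 ht ⊢
    rw [show (fun j => A.mulVec (fun i => t ^ (i : ℕ)) j) = _ from h1, hf.eval_smul]
    simp [ht]
  apply le_antisymm
  · refine Ideal.span_le.2 ?_
    rintro f ⟨⟨m, hf⟩, hfZ⟩
    refine (mem_paramIdeal_of_isHomogeneous hf).2 ?_
    refine Polynomial.eq_zero_of_infinite_isRoot _
      ((infinite_setOf_eval_ne_zero hA).mono fun t ht => ?_)
    refine (key f m hf t ht).2 ((hf.eval_rep_mk_eq_zero_iff (snoc_one_ne_zero _)).1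
      (hfZ _ ⟨_, zeroLocus_vanishingIdeal_le _ ⟨t, ht, fun i => rfl⟩, rfl⟩))
  · intro f hf
    rw [mem_paramIdeal_iff] at hf
    rw [← sum_homogeneousComponent f]
    refine sum_mem fun m _ => Ideal.subset_span
      ⟨⟨m, homogeneousComponent_isHomogeneous _ _⟩, ?_⟩
    rintro _ ⟨x, hx, rfl⟩
    have hm := homogeneousComponent_isHomogeneous m f
    rw [hm.eval_rep_mk_eq_zero_iff, ← eval_aeval_snoc, ← coe_aeval_eq_eval, RingHom.coe_coe]
    refine hx _ fun y hy => ?_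
    obtain ⟨t, ht, hyt⟩ := hy
    rw [← RingHom.coe_coe, coe_aeval_eq_eval, eval_aeval_snoc, funext hyt, ← key _ m hm t ht, hf,
      Polynomial.eval_zero]

/-- The coefficients of `pᵢ = aᵢ q + ∑ₖ Qᵢₖ tᵏ`, for `i < n`, and of `q = ∑ₖ cₖ tᵏ`. -/
def curveMatrix {R : Type*} [CommRing R] (a : Fin n → R) (Q : Matrix (Fin n) (Fin r) R)
    (c : Fin (r + 1) → R) : Matrix (Fin (n + 1)) (Fin (r + 1)) R :=
  Fin.snoc (fun i k => a i * c k + (Fin.snoc (Q i) 0 : Fin (r + 1) → R) k) c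

variable {a : Fin n → F} {Q : Matrix (Fin n) (Fin r) F} {c : Fin (r + 1) → F}

theorem rowPoly_curveMatrix_last :
    rowPoly (curveMatrix a Q c) (Fin.last n) = coeffPoly c := by
  simp [rowPoly, coeffPoly, curveMatrix]

theorem rowPoly_curveMatrix_castSucc (i : Fin n) :
    rowPoly (curveMatrix a Q c) (Fin.castSucc i) =
      Polynomial.C (a i) * coeffPoly c +
        ∑ k, Polynomial.C (Q i k) * Polynomial.X ^ (k : ℕ) := by
  simp only [rowPoly, coeffPoly, curveMatrix, Fin.snoc_castSucc, Polynomial.C_add,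
    Polynomial.C_mul, add_mul, Finset.sum_add_distrib, Finset.mul_sum, mul_assoc]
  congr 1
  rw [Fin.sum_univ_castSucc]
  simp

theorem exists_mul_eq_one_of_injective {ι κ : Type*} [Fintype ι] [Fintype κ] [DecidableEq κ]
    {A : Matrix ι κ F} (hA : ∀ v, A.mulVec v = 0 → v = 0) :
    ∃ B : Matrix κ ι F, B * A = 1 := by
  classical
  obtain ⟨g, hg⟩ := LinearMap.exists_leftInverse_of_injective A.mulVecLin
    (LinearMap.ker_eq_bot'.2 hA)
  refine ⟨LinearMap.toMatrix' g, ?_⟩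
  have h := congrArg LinearMap.toMatrix' hg
  rw [LinearMap.toMatrix'_comp, LinearMap.toMatrix'_id] at h
  rw [← h]
  congr 1
  exact (LinearMap.toMatrix'_toLin' A).symm

/-- For `v` in the kernel, the last row gives `c · v = 0`. Removing `aᵢ` times it from the other
rows leaves `Q` applied to the first `r` coordinates, which therefore vanish; then `c r = 1` kills
the last one. -/
theorem exists_mul_curveMatrix_eq_one {D : Matrix (Fin r) (Fin n) F} (hDQ : D * Q = 1)
    (hc : c (Fin.last r) = 1) : ∃ B : Matrix (Fin (r + 1)) (Fin (n + 1)) F,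
      B * curveMatrix a Q c = 1 := by
  refine exists_mul_eq_one_of_injective fun v hv => ?_
  have h1 : dotProduct c v = 0 := by
    have := congrFun hv (Fin.last n)
    simpa [Matrix.mulVec, curveMatrix] using this
  have h2 : Q.mulVec (fun k => v (Fin.castSucc k)) = 0 := by
    ext i
    have := congrFun hv (Fin.castSucc i)
    simp only [Matrix.mulVec, curveMatrix, Fin.snoc_castSucc, Pi.zero_apply] at this
    have h3 : ∑ k, (a i * c k + (Fin.snoc (Q i) 0 : Fin (r + 1) → F) k) * v k =
        a i * dotProduct c v + ∑ k, Q i k * v (Fin.castSucc k) := by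
      simp only [add_mul, Finset.sum_add_distrib, dotProduct, Finset.mul_sum, mul_assoc]
      congr 1
      rw [Fin.sum_univ_castSucc]
      simp
    rw [dotProduct, h3, h1, mul_zero, zero_add] at this
    exact this
  have h3 : (fun k => v (Fin.castSucc k)) = 0 := by
    have := congrArg D.mulVec h2
    simpa [Matrix.mulVec_mulVec, hDQ] using this
  ext k
  refine Fin.lastCases ?_ (fun k => congrFun h3 k) k
  rw [dotProduct, Fin.sum_univ_castSucc, hc, one_mul, Finset.sum_eq_zero, zero_add] at h1
  · exact h1
  · intro k _
    rw [show v k.castSucc = 0 from congrFun h3 k, mul_zero]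

theorem mem_rationalPoints_curveMatrix {x : Fin n → F} :
    x ∈ rationalPoints (curveMatrix a Q c) ↔ ∃ t, (coeffPoly c).eval t ≠ 0 ∧
      x = a + ((coeffPoly c).eval t)⁻¹ • Q.mulVec fun k => t ^ (k : ℕ) := by
  simp only [rationalPoints, Set.mem_ofPred_eq, rowPoly_curveMatrix_last,
    rowPoly_curveMatrix_castSucc]
  refine exists_congr fun t => and_congr_right fun ht => ?_
  rw [funext_iff]
  refine forall_congr' fun i => ?_
  have : (Polynomial.C (a i) * coeffPoly c +
      ∑ k, Polynomial.C (Q i k) * Polynomial.X ^ (k : ℕ)).eval t / (coeffPoly c).eval t =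
      (a + ((coeffPoly c).eval t)⁻¹ • Q.mulVec fun k => t ^ (k : ℕ)) i := by
    simp only [Polynomial.eval_add, Polynomial.eval_mul, Polynomial.eval_C,
      Polynomial.eval_finsetSum, Polynomial.eval_pow, Polynomial.eval_X, Pi.add_apply,
      Pi.smul_apply, smul_eq_mul, Matrix.mulVec, dotProduct]
    field_simp
  rw [this]

/-- The subspace is `a` plus the column space of `Q`. Its equations `w · (x - a) = 0`, with `w Q =
0`, hold on the parametrized points and so on their closure. -/
theorem exists_affineSubspace_supset {D : Matrix (Fin r) (Fin n) F} (hDQ : D * Q = 1) :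
    ∃ E : AffineSubspace F (Fin n → F), Module.finrank F E.direction = r ∧
      zeroLocus F (vanishingIdeal F (rationalPoints (curveMatrix a Q c))) ⊆ E := by
  have hinj : Function.Injective Q.mulVecLin := fun u v huv => by
    have := congrArg D.mulVec huv
    simpa [Matrix.mulVec_mulVec, hDQ] using this
  refine ⟨AffineSubspace.mk' a (LinearMap.range Q.mulVecLin), ?_, fun x hx => ?_⟩
  · rw [AffineSubspace.direction_mk', LinearMap.finrank_range_of_inj hinj,
      Module.finrank_fin_fun]
  · rw [SetLike.mem_coe, AffineSubspace.mem_mk', vsub_eq_sub]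
    refine ⟨D.mulVec (x - a), mulVec_mulVec_of_annihilated hDQ fun w hw => ?_⟩
    have h : ∀ y : Fin n → F, aeval y (∑ i, C (w i) * (X i - C (a i)) : MvPolynomial (Fin n) F) =
        dotProduct w (y - a) := by
      intro y
      simp [dotProduct]
    rw [← h]
    refine hx _ fun y hy => ?_
    obtain ⟨t, -, rfl⟩ := mem_rationalPoints_curveMatrix.1 hy
    rw [h, add_sub_cancel_left, dotProduct_smul, Matrix.dotProduct_mulVec, hw, zero_dotProduct,
      smul_zero]

/-- A functional `φ` killing the direction of `E` is constant on the differences `x - a`, so `∑ₖ φ(Q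
eₖ) tᵏ = κ q(t)` with `q = coeffPoly c`. The left side has degree below `r` and `q` is monic of
degree `r`; hence `κ = 0` and `φ` kills the column space of `Q`, which must lie in the direction. -/
theorem le_finrank_direction_of_supset [Infinite F] {D : Matrix (Fin r) (Fin n) F}
    (hDQ : D * Q = 1) (hc : c (Fin.last r) = 1) {E : AffineSubspace F (Fin n → F)}
    (hE : rationalPoints (curveMatrix a Q c) ⊆ E) : r ≤ Module.finrank F E.direction := by
  have hinj : Function.Injective Q.mulVecLin := fun u v huv => by
    have := congrArg D.mulVec huv
    simpa [Matrix.mulVec_mulVec, hDQ] using this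
  have hc0 : coeffPoly c ≠ 0 := by
    intro h
    have := coeff_coeffPoly c (Fin.last r)
    rw [h, hc, Polynomial.coeff_zero] at this
    exact zero_ne_one this
  have hinf := infinite_setOf_eval_ne_zero hc0
  obtain ⟨s, hs⟩ := hinf.nonempty
  have hle : LinearMap.range Q.mulVecLin ≤ E.direction := by
    intro v hv
    rw [← Subspace.forall_mem_dualAnnihilator_apply_eq_zero_iff]
    intro φ hφ
    rw [Submodule.mem_dualAnnihilator] at hφ
    let κ := ((coeffPoly c).eval s)⁻¹ * φ (Q.mulVec fun k => s ^ (k : ℕ))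
    have hsum : ∀ u : Fin r → F, φ (Q.mulVec u) = ∑ k, φ (Q.mulVec (Pi.single k 1)) * u k := by
      intro u
      have h1 := congrArg (φ ∘ₗ Q.mulVecLin) (pi_eq_sum_univ' u)
      simp only [map_sum, map_smul, smul_eq_mul, LinearMap.comp_apply,
        Matrix.mulVecLin_apply] at h1
      rw [h1]
      refine Finset.sum_congr rfl fun k _ => ?_
      rw [mul_comm]
    have hpoly : coeffPoly ((Fin.snoc (fun k => φ (Q.mulVec (Pi.single k 1))) 0 :
        Fin (r + 1) → F) - κ • c) = 0 := by
      refine Polynomial.eq_zero_of_infinite_isRoot _ (hinf.mono fun t ht => ?_)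
      have ht' : (coeffPoly c).eval t ≠ 0 := ht
      have h1 := hφ _ (AffineSubspace.vsub_mem_direction
        (hE (mem_rationalPoints_curveMatrix.2 ⟨t, ht, rfl⟩))
        (hE (mem_rationalPoints_curveMatrix.2 ⟨s, hs, rfl⟩)))
      rw [vsub_eq_sub, add_sub_add_left_eq_sub, map_sub, map_smul, map_smul, smul_eq_mul,
        smul_eq_mul, hsum, sub_eq_zero] at h1
      have h2 : dotProduct (Fin.snoc (fun k => φ (Q.mulVec (Pi.single k 1))) 0 : Fin (r + 1) → F)
          (fun i => t ^ (i : ℕ)) = ∑ k, φ (Q.mulVec (Pi.single k 1)) * t ^ (k : ℕ) := by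
        rw [dotProduct, Fin.sum_univ_castSucc]
        simp
      rw [Set.mem_ofPred_eq, Polynomial.IsRoot, eval_coeffPoly, sub_dotProduct, smul_dotProduct,
        h2, ← eval_coeffPoly]
      rw [inv_mul_eq_iff_eq_mul₀ ht'] at h1
      rw [h1, smul_eq_mul, mul_comm, sub_self]
    have hκ : κ = 0 := by
      have h1 := coeff_coeffPoly ((Fin.snoc (fun k => φ (Q.mulVec (Pi.single k 1))) 0 :
        Fin (r + 1) → F) - κ • c) (Fin.last r)
      rw [hpoly, Polynomial.coeff_zero] at h1
      simpa [hc] using h1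
    obtain ⟨u, rfl⟩ := hv
    rw [Matrix.mulVecLin_apply, hsum]
    refine Finset.sum_eq_zero fun k _ => ?_
    have h1 := coeff_coeffPoly ((Fin.snoc (fun k => φ (Q.mulVec (Pi.single k 1))) 0 :
      Fin (r + 1) → F) - κ • c) (Fin.castSucc k)
    rw [hpoly, Polynomial.coeff_zero, hκ, zero_smul, sub_zero, Fin.snoc_castSucc] at h1
    rw [← h1, zero_mul]
  calc r = Module.finrank F (LinearMap.range Q.mulVecLin) := by
        rw [LinearMap.finrank_range_of_inj hinj, Module.finrank_fin_fun]
    _ ≤ _ := Submodule.finrank_mono hle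

end AffineCurve

/-! ### The expansion of `u` over `K` and the rank of its coefficient matrix. -/

noncomputable section Arithmetic

variable {K L : Type*} [Field K] [Field L] [Algebra K L]

/-- These `r` coefficients span `K[x]`, which has dimension `r`. -/
theorem linearIndependent_coeff_minpolyDiv {x : L} (hx : IsIntegral K x) {r : ℕ}
    (hr : (minpoly K x).natDegree = r) :
    LinearIndependent K fun k : Fin r => (minpolyDiv K x).coeff k := by
  rw [linearIndependent_iff_card_le_finrank_span, Fintype.card_fin, Set.finrank]
  have hdeg : ∀ k, r ≤ k → (minpolyDiv K x).coeff k = 0 := fun k hk =>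
    Polynomial.coeff_eq_zero_of_natDegree_lt
      (lt_of_lt_of_le (hr ▸ natDegree_minpolyDiv_lt hx) hk)
  have hspan : Submodule.span K (Set.range fun k : Fin r => (minpolyDiv K x).coeff k) =
      Subalgebra.toSubmodule (Algebra.adjoin K {x}) := by
    rw [← span_coeff_minpolyDiv hx]
    apply le_antisymm
    · refine Submodule.span_mono ?_
      rintro _ ⟨k, rfl⟩
      exact ⟨k, rfl⟩
    · rw [Submodule.span_le]
      rintro _ ⟨k, rfl⟩
      by_cases hk : k < r
      · exact Submodule.subset_span ⟨⟨k, hk⟩, rfl⟩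
      · rw [hdeg k (not_lt.1 hk)]
        exact zero_mem _
  rw [hspan]
  have h := (Algebra.adjoin.powerBasis hx).finrank
  rw [Algebra.adjoin.powerBasis_dim, hr] at h
  exact h.ge

theorem coeffPoly_minpoly {F : Type*} [Field F] [Algebra K F] {x : L} {r : ℕ}
    (hr : (minpoly K x).natDegree = r) :
    coeffPoly (fun k : Fin (r + 1) => algebraMap K F ((minpoly K x).coeff k)) =
      (minpoly K x).map (algebraMap K F) := by
  conv_rhs => rw [Polynomial.as_sum_range_C_mul_X_pow' (minpoly K x)
    (Nat.lt_succ_of_le hr.le), Finset.sum_range]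
  simp [coeffPoly, Polynomial.map_sum]

variable [FiniteDimensional K L]

/-- The basis `1, α, …, αⁿ⁻¹` of `L` over `K`. -/
def powersBasis {α : L} (hα : IntermediateField.adjoin K {α} = ⊤) :
    Module.Basis (Fin (Module.finrank K L)) K L :=
  have : Nonempty (Fin (Module.finrank K L)) := ⟨⟨0, Module.finrank_pos⟩⟩
  basisOfLinearIndependentOfCardEqFinrank (linearIndependent_powers hα) (Fintype.card_fin _)

theorem powersBasis_apply {α : L} (hα : IntermediateField.adjoin K {α} = ⊤)
    (i : Fin (Module.finrank K L)) : powersBasis hα i = α ^ (i : ℕ) := by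
  simp [powersBasis]

theorem sum_repr_powersBasis {α : L} (hα : IntermediateField.adjoin K {α} = ⊤) (x : L) :
    ∑ i, algebraMap K L ((powersBasis hα).repr x i) * α ^ (i : ℕ) = x := by
  conv_rhs => rw [← (powersBasis hα).sum_repr x]
  simp only [powersBasis_apply, Algebra.smul_def]

/-- The coordinates of the coefficients of `c m(t)`, where `(t - x) m(t)` is the minimal
polynomial of `x`. -/
def numeratorMatrix {α : L} (hα : IntermediateField.adjoin K {α} = ⊤) (r : ℕ) (c x : L) :
    Matrix (Fin (Module.finrank K L)) (Fin r) K :=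
  fun i k => (powersBasis hα).repr (c * (minpolyDiv K x).coeff k) i

theorem numeratorMatrix_mulVec_eq_zero {α : L} (hα : IntermediateField.adjoin K {α} = ⊤) {r : ℕ}
    {c x : L} (hc : c ≠ 0) (hr : (minpoly K x).natDegree = r) {v : Fin r → K}
    (hv : (numeratorMatrix hα r c x).mulVec v = 0) : v = 0 := by
  have h1 : (powersBasis hα).repr (∑ k, v k • (c * (minpolyDiv K x).coeff k)) = 0 := by
    ext i
    have h := congrFun hv i
    simp only [Matrix.mulVec, dotProduct, numeratorMatrix, Pi.zero_apply] at h
    simp only [map_sum, map_smul, Finsupp.coe_finsetSum, Finset.sum_apply, Finsupp.smul_apply,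
      smul_eq_mul, Finsupp.zero_apply]
    rw [← h]
    exact Finset.sum_congr rfl fun k _ => mul_comm _ _
  rw [(powersBasis hα).repr.map_eq_zero_iff] at h1
  have h2 : c * ∑ k, v k • (minpolyDiv K x).coeff k = 0 := by
    rw [← h1, Finset.mul_sum]
    exact Finset.sum_congr rfl fun k _ => by rw [mul_smul_comm]
  have h3 := (mul_eq_zero.1 h2).resolve_left hc
  have hli := linearIndependent_coeff_minpolyDiv (Algebra.IsIntegral.isIntegral (R := K) x) hr
  ext k
  exact Fintype.linearIndependent_iff.1 hli v h3 k

/-- The numerators of the coordinates of `a + c / (t - x)` over the minimal polynomial of `x`. -/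
def numerator {α : L} (hα : IntermediateField.adjoin K {α} = ⊤) (r : ℕ) (a c x : L)
    (i : Fin (Module.finrank K L)) : Polynomial K :=
  Polynomial.C ((powersBasis hα).repr a i) * minpoly K x +
    ∑ k, Polynomial.C (numeratorMatrix hα r c x i k) * Polynomial.X ^ (k : ℕ)

theorem sum_numerator {α : L} (hα : IntermediateField.adjoin K {α} = ⊤) {r : ℕ} (a c : L) {x : L}
    (hr : (minpoly K x).natDegree = r) :
    ∑ i, (numerator hα r a c x i).map (algebraMap K L) * Polynomial.C α ^ (i : ℕ) =
      Polynomial.C a * (minpoly K x).map (algebraMap K L) + Polynomial.C c * minpolyDiv K x := by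
  have hx := Algebra.IsIntegral.isIntegral (R := K) x
  simp only [numerator, Polynomial.map_add, Polynomial.map_mul, Polynomial.map_C,
    Polynomial.map_sum, Polynomial.map_pow, Polynomial.map_X, add_mul, Finset.sum_add_distrib]
  congr 1
  · conv_rhs => rw [← sum_repr_powersBasis hα a]
    rw [map_sum, Finset.sum_mul]
    refine Finset.sum_congr rfl fun i _ => ?_
    rw [Polynomial.C_mul, Polynomial.C_pow]
    ring
  · simp only [Finset.sum_mul]
    rw [Finset.sum_comm]
    conv_rhs => rw [Polynomial.as_sum_range_C_mul_X_pow' (minpolyDiv K x)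
      (hr ▸ natDegree_minpolyDiv_lt hx), Finset.mul_sum, Finset.sum_range]
    refine Finset.sum_congr rfl fun k _ => ?_
    rw [← mul_assoc, ← Polynomial.C_mul]
    conv_rhs => rw [← sum_repr_powersBasis hα (c * (minpolyDiv K x).coeff k)]
    rw [map_sum, Finset.sum_mul]
    refine Finset.sum_congr rfl fun i _ => ?_
    rw [Polynomial.C_mul, Polynomial.C_pow, numeratorMatrix]
    ring

/-- Writing `u = a + c / (t - x) = (a M + c m) / M` puts it over a denominator in `K[t]`; uniqueness
of the expansion then identifies the coordinates. -/
theorem coordinates_linearFractional {α : L} (hα : IntermediateField.adjoin K {α} = ⊤)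
    (a b d : L) {r : ℕ} (hr : (minpoly K (-d)).natDegree = r) :
    coordinates hα ((RatFunc.C a * RatFunc.X + RatFunc.C b) / (RatFunc.X + RatFunc.C d)) =
      fun i => algebraMap _ _ (numerator hα r a (b - a * d) (-d) i) /
        algebraMap _ _ (minpoly K (-d)) := by
  refine (existsUnique_expansion hα _).unique (isExpansion_coordinates hα _) ?_
  have hx := Algebra.IsIntegral.isIntegral (R := K) (-d)
  have hinj : Function.Injective (algebraMap (Polynomial L) (RatFunc L)) :=
    RatFunc.algebraMap_injective L
  have hM : algebraMap (Polynomial L) (RatFunc L) ((minpoly K (-d)).map (algebraMap K L)) ≠ 0 := by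
    rw [Ne, map_eq_zero_iff _ hinj, Polynomial.map_eq_zero]
    exact minpoly.ne_zero hx
  have hspec := minpolyDiv_spec K (-d)
  rw [Polynomial.C_neg, sub_neg_eq_add] at hspec
  have hd : (RatFunc.X + RatFunc.C d : RatFunc L) ≠ 0 := by
    have : (RatFunc.X + RatFunc.C d : RatFunc L) =
        algebraMap (Polynomial L) (RatFunc L) (Polynomial.X + Polynomial.C d) := by
      rw [map_add, RatFunc.algebraMap_X, RatFunc.algebraMap_C]
    rw [this, Ne, map_eq_zero_iff _ hinj]
    exact Polynomial.X_add_C_ne_zero d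
  rw [IsExpansion]
  have h1 : ∑ i, ratFuncMap K L (algebraMap _ _ (numerator hα r a (b - a * d) (-d) i) /
      algebraMap _ _ (minpoly K (-d))) * RatFunc.C α ^ (i : ℕ) =
      algebraMap (Polynomial L) (RatFunc L)
        (∑ i, (numerator hα r a (b - a * d) (-d) i).map (algebraMap K L) *
          Polynomial.C α ^ (i : ℕ)) /
        algebraMap (Polynomial L) (RatFunc L) ((minpoly K (-d)).map (algebraMap K L)) := by
    rw [map_sum, Finset.sum_div]
    refine Finset.sum_congr rfl fun i _ => ?_
    rw [map_div₀, ratFuncMap_algebraMap, ratFuncMap_algebraMap, map_mul, map_pow,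
      RatFunc.algebraMap_C]
    ring
  rw [h1, sum_numerator hα _ _ hr, div_eq_div_iff hd hM, ← hspec]
  simp only [map_add, map_mul, map_sub, RatFunc.algebraMap_C, RatFunc.algebraMap_X]
  ring

/-- Otherwise `M` would divide every tail `∑ₖ Qᵢₖ tᵏ`, of degree below `r`, forcing `Q = 0` against
its injectivity. Thus some coordinate really has a pole at the roots of `M`. -/
theorem exists_not_dvd_numerator {α : L} (hα : IntermediateField.adjoin K {α} = ⊤) {r : ℕ}
    (a : L) {c x : L} (hc : c ≠ 0) (hr : (minpoly K x).natDegree = r) :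
    ∃ i, ¬ minpoly K x ∣ numerator hα r a c x i := by
  have hx := Algebra.IsIntegral.isIntegral (R := K) x
  have hr0 : 0 < r := hr ▸ minpoly.natDegree_pos hx
  by_contra! h
  have h1 : ∀ i k, numeratorMatrix hα r c x i k = 0 := by
    intro i k
    have h3 := h i
    rw [numerator, dvd_add_right (dvd_mul_left _ _)] at h3
    have h4 := Polynomial.eq_zero_of_dvd_of_natDegree_lt h3 (lt_of_le_of_lt
      (Polynomial.natDegree_sum_le_of_forall_le (n := r - 1) _ _ fun k _ =>
        (Polynomial.natDegree_C_mul_X_pow_le _ _).trans (by omega)) (by omega))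
    have h5 := congrArg (fun q => Polynomial.coeff q k) h4
    simp only [Polynomial.finsetSum_coeff, Polynomial.coeff_C_mul_X_pow, Polynomial.coeff_zero] at h5
    rw [Finset.sum_eq_single k] at h5
    · simpa using h5
    · intro j _ hj
      simp [Fin.val_inj, hj.symm]
    · simp
  have h6 := numeratorMatrix_mulVec_eq_zero hα hc hr (v := Pi.single ⟨0, hr0⟩ 1) (by
    ext i
    simp [h1])
  simpa using congrFun h6 ⟨0, hr0⟩

variable (F : Type*) [Field F] [Algebra K F]

/-- The matrix of the coefficients of the parametrization of the hypercircle generated by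
`a + c / (t - x)`. -/
def hypercircleMatrix {α : L} (hα : IntermediateField.adjoin K {α} = ⊤) (r : ℕ) (a c x : L) :
    Matrix (Fin (Module.finrank K L + 1)) (Fin (r + 1)) F :=
  curveMatrix (fun i => algebraMap K F ((powersBasis hα).repr a i))
    ((numeratorMatrix hα r c x).map (algebraMap K F))
    (fun k => algebraMap K F ((minpoly K x).coeff k))

variable {F}

theorem rowPoly_hypercircleMatrix_last {α : L} (hα : IntermediateField.adjoin K {α} = ⊤) {r : ℕ}
    (a c : L) {x : L} (hr : (minpoly K x).natDegree = r) :
    rowPoly (hypercircleMatrix F hα r a c x) (Fin.last _) =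
      (minpoly K x).map (algebraMap K F) := by
  rw [hypercircleMatrix, rowPoly_curveMatrix_last, coeffPoly_minpoly hr]

theorem rowPoly_hypercircleMatrix_castSucc {α : L} (hα : IntermediateField.adjoin K {α} = ⊤)
    {r : ℕ} (a c : L) {x : L} (hr : (minpoly K x).natDegree = r) (i : Fin (Module.finrank K L)) :
    rowPoly (hypercircleMatrix F hα r a c x) (Fin.castSucc i) =
      (numerator hα r a c x i).map (algebraMap K F) := by
  rw [hypercircleMatrix, rowPoly_curveMatrix_castSucc, coeffPoly_minpoly hr]
  simp [numerator, Polynomial.map_sum]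

theorem eval₂_denom_ne_zero_of_dvd {p q : Polynomial K} {t : F} (hpq : p ∣ q)
    (h : q.eval₂ (algebraMap K F) t ≠ 0) : p.eval₂ (algebraMap K F) t ≠ 0 := by
  obtain ⟨s, rfl⟩ := hpq
  rw [Polynomial.eval₂_mul] at h
  exact left_ne_zero_of_mul h

/-- The point at issue is which `t` are excluded: on the left by the reduced denominators, on the
right by the common denominator `M`. -/
theorem parametrizedPoints_eq_rationalPoints {α : L}
    (hα : IntermediateField.adjoin K {α} = ⊤) (a b d : L) (hu : a * d - b ≠ 0) {r : ℕ}
    (hr : (minpoly K (-d)).natDegree = r) :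
    parametrizedPoints F (coordinates hα
        ((RatFunc.C a * RatFunc.X + RatFunc.C b) / (RatFunc.X + RatFunc.C d))) =
      rationalPoints (hypercircleMatrix F hα r a (b - a * d) (-d)) := by
  have hx := Algebra.IsIntegral.isIntegral (R := K) (-d)
  have hM : minpoly K (-d) ≠ 0 := minpoly.ne_zero hx
  have hc : b - a * d ≠ 0 := fun h => hu (by rw [← neg_sub, h, neg_zero])
  rw [coordinates_linearFractional hα a b d hr]
  set p := numerator hα r a (b - a * d) (-d) with hp
  set φ : Fin (Module.finrank K L) → RatFunc K := fun i => algebraMap _ _ (p i) /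
    algebraMap _ _ (minpoly K (-d)) with hφ
  have hdvd : ∀ i, (φ i).denom ∣ minpoly K (-d) := fun i => RatFunc.denom_div_dvd _ _
  have hcross : ∀ i, (φ i).num * minpoly K (-d) = p i * (φ i).denom := fun i =>
    (RatFunc.num_mul_eq_mul_denom_iff hM).2 rfl
  have hval : ∀ t : F, Polynomial.eval₂ (algebraMap K F) t (minpoly K (-d)) ≠ 0 → ∀ i,
      Polynomial.eval₂ (algebraMap K F) t (φ i).num /
        Polynomial.eval₂ (algebraMap K F) t (φ i).denom =
      Polynomial.eval₂ (algebraMap K F) t (p i) /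
        Polynomial.eval₂ (algebraMap K F) t (minpoly K (-d)) := by
    intro t ht i
    rw [div_eq_div_iff (eval₂_denom_ne_zero_of_dvd (hdvd i) ht) ht, ← Polynomial.eval₂_mul,
      ← Polynomial.eval₂_mul, hcross]
  ext x
  simp only [parametrizedPoints, rationalPoints, Set.mem_ofPred_eq,
    rowPoly_hypercircleMatrix_last hα a _ hr, rowPoly_hypercircleMatrix_castSucc hα a _ hr,
    Polynomial.eval_map]
  refine exists_congr fun t => ⟨fun h => ?_, fun h i => ?_⟩
  · have ht : Polynomial.eval₂ (algebraMap K F) t (minpoly K (-d)) ≠ 0 := by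
      intro ht
      obtain ⟨i, hi⟩ := exists_not_dvd_numerator hα a hc hr
      -- As `M` is irreducible, a reduced denominator is a unit or an associate of `M`; for this `i`
      -- a unit would make `M` divide the numerator.
      rcases (minpoly.irreducible hx).dvd_iff.1 (hdvd i) with h1 | h1
      · apply hi
        rw [← hp, ← h1.dvd_mul_right, ← hcross]
        exact dvd_mul_left _ _
      · exact eval₂_denom_ne_zero_of_dvd h1.dvd (h i).1 ht
    exact ⟨ht, fun i => by rw [(h i).2, hval t ht]⟩
  · exact ⟨eval₂_denom_ne_zero_of_dvd (hdvd i) h.1, by rw [h.2, hval t h.1]⟩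

end Arithmetic

end Hypercircle

/-! ### The theorem. -/

theorem mainTheorem2 {K L F : Type*} [Field K] [CharZero K] [Field L] [Algebra K L]
    [FiniteDimensional K L] [Field F] [Algebra K F] [IsAlgClosure K F]
    (α : L) (hα : IntermediateField.adjoin K {α} = ⊤)
    (a b d : L) (hu : a * d - b ≠ 0)
    (u : RatFunc L)
    (hu_eq : u = (RatFunc.C a * RatFunc.X + RatFunc.C b) / (RatFunc.X + RatFunc.C d))
    (r : ℕ) (hr : r = Module.finrank K (IntermediateField.adjoin K {-d})) :
    -- the hypercircle is a curve of degree `r`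
    (Hypercircle.IsProjectiveCurve
        (Hypercircle.projectiveClosure (Hypercircle.hypercircle F hα u)) ∧
      Hypercircle.HasDegree
        (Hypercircle.projectiveClosure (Hypercircle.hypercircle F hα u)) r) ∧
    -- it lies in a linear variety of dimension `r`, and in none of smaller dimension
    ((∃ E : AffineSubspace F (Fin (Module.finrank K L) → F),
        Module.finrank F E.direction = r ∧ Hypercircle.hypercircle F hα u ⊆ E) ∧
      ∀ E : AffineSubspace F (Fin (Module.finrank K L) → F),
        Hypercircle.hypercircle F hα u ⊆ E → ¬ Module.finrank F E.direction < r) ∧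
    -- it is a regular curve in projective space
    Hypercircle.IsRegularCurve
      (Hypercircle.projectiveClosure (Hypercircle.hypercircle F hα u)) ∧
    -- the Hilbert function equals the Hilbert polynomial, which is `r * m + 1`
    (∃ P : Polynomial ℚ,
      Hypercircle.IsHilbertPolynomial
        (Hypercircle.projectiveClosure (Hypercircle.hypercircle F hα u)) P ∧
      P = Polynomial.C (r : ℚ) * Polynomial.X + 1 ∧
      ∀ m : ℕ, (Hypercircle.hilbertFunction
        (Hypercircle.projectiveClosure (Hypercircle.hypercircle F hα u)) m : ℚ) =
          P.eval (m : ℚ)) := by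
  have hx := Algebra.IsIntegral.isIntegral (R := K) (-d)
  have hc : b - a * d ≠ 0 := fun h => hu (by rw [← neg_sub, h, neg_zero])
  have hdeg : (minpoly K (-d)).natDegree = r := by
    rw [hr, IntermediateField.adjoin.finrank hx]
  have hr0 : 0 < r := hdeg ▸ minpoly.natDegree_pos hx
  have : IsAlgClosed F := IsAlgClosure.isAlgClosed K
  have : CharZero F := charZero_of_injective_algebraMap (algebraMap K F).injective
  have : Infinite F := IsAlgClosed.instInfinite
  have hU : Hypercircle.hypercircle F hα u = MvPolynomial.zeroLocus F
      (MvPolynomial.vanishingIdeal F (Hypercircle.rationalPoints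
        (Hypercircle.hypercircleMatrix F hα r a (b - a * d) (-d)))) := by
    rw [Hypercircle.hypercircle, hu_eq,
      Hypercircle.parametrizedPoints_eq_rationalPoints hα a b d hu hdeg]
  -- Independence is known over `K` only; a left inverse matrix carries it over to `F`.
  obtain ⟨D₀, hD₀⟩ := Hypercircle.exists_mul_eq_one_of_injective fun v hv =>
    Hypercircle.numeratorMatrix_mulVec_eq_zero hα hc hdeg (v := v) hv
  have hD : D₀.map (algebraMap K F) *
      (Hypercircle.numeratorMatrix hα r (b - a * d) (-d)).map (algebraMap K F) = 1 := by
    rw [← Matrix.map_mul, hD₀, Matrix.map_one _ (map_zero _) (map_one _)]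
  have hlast : algebraMap K F ((minpoly K (-d)).coeff (Fin.last r)) = 1 := by
    rw [Fin.val_last, ← hdeg, Polynomial.coeff_natDegree, (minpoly.monic hx).leadingCoeff, map_one]
  obtain ⟨B, hB⟩ := Hypercircle.exists_mul_curveMatrix_eq_one
    (a := fun i => algebraMap K F ((Hypercircle.powersBasis hα).repr a i))
    (c := fun k => algebraMap K F ((minpoly K (-d)).coeff k)) hD hlast
  have hI := Hypercircle.homogeneousIdeal_projectiveClosure
    (A := Hypercircle.hypercircleMatrix F hα r a (b - a * d) (-d)) (by
      rw [Hypercircle.rowPoly_hypercircleMatrix_last hα a _ hdeg, Ne, Polynomial.map_eq_zero]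
      exact minpoly.ne_zero hx)
  rw [← hU] at hI
  have hcl : Hypercircle.zariskiClosure
      (Hypercircle.projectiveClosure (Hypercircle.hypercircle F hα u)) =
      Hypercircle.projectiveClosure (Hypercircle.hypercircle F hα u) :=
    Hypercircle.zariskiClosure_zariskiClosure _
  have hH : ∀ m : ℕ, (Hypercircle.hilbertFunction
      (Hypercircle.projectiveClosure (Hypercircle.hypercircle F hα u)) m : ℚ) =
        (Polynomial.C (r : ℚ) * Polynomial.X + 1).eval (m : ℚ) := by
    intro m
    rw [Hypercircle.hilbertFunction_of_homogeneousIdeal_eq hI hB]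
    simp [mul_comm]
  refine ⟨⟨Hypercircle.isProjectiveCurve_of_homogeneousIdeal_eq hr0 hcl hI hB,
    Hypercircle.hasDegree_of_homogeneousIdeal_eq hr0 hcl hI hB⟩, ⟨?_, fun E hE => ?_⟩,
    Hypercircle.isRegularCurve_of_homogeneousIdeal_eq hr0 hcl hI hB,
    _, Filter.Eventually.of_forall hH, rfl, hH⟩
  · rw [hU]
    exact Hypercircle.exists_affineSubspace_supset hD
  · rw [not_lt]
    rw [hU] at hE
    exact Hypercircle.le_finrank_direction_of_supset hD hlast
      ((MvPolynomial.zeroLocus_vanishingIdeal_le _).trans hE)
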